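/- Let $\mathbb F_q$ be a finite field with $q$ elements, and let $\mathbb F_q((T^{-1}))$ be the field of Laurent series in $T^{-1}$, with the absolute value $|0|=0$ and $|\xi|=q^{-N}$ for $\xi=\sum_{n\ge N}a_nT^{-n}$ with $a_N\neq 0$; extend $|\cdot|$ (uniquely) to an algebraic closure. The height $H(P)$ of $P(X)\in(\mathbb F_q[T])[X]$ is the maximum of the absolute values of its coefficients. The minimal polynomial of an element $\alpha$ algebraic over $\mathbb F_q(T)$ is the unique non-constant, irreducible, primitive polynomial in $(\mathbb F_q[T])[X]$ whose leading coefficient is a monic polynomial in $T$ and which vanishes at $\alpha$; $\deg\alpha$ and $H(\alpha)$ are the degree and the height of this polynomial. For $n\ge 1$ and $\xi\in\mathbb F_q((T^{-1}))$, let $w_n(\xi)$ be the supremum of the real numbers $v$ such that $0<|P(\xi)|\le H(P)^{-v}$ for infinitely many $P(X)\in(\mathbb F_q[T])[X]$ of degree at most $n$, and let $w_n^*(\xi)$ be the supremum of the real numbers $v$ such that $0<|\xi-\alpha|\le H(\alpha)^{-v-1}$ for infinitely many $\alpha\in\overline{\mathbb F_q(T)}$ of degree at most $n$. For non-constant polynomials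 $a_1,a_2,\ldots\in\mathbb F_q[T]$, write $[0,a_1,a_2,\ldots]=\cfrac{1}{a_1+\cfrac{1}{a_2+\cdots}}\in\mathbb F_q((T^{-1}))$ for the limit of the convergents. **Theorem.** Let $d\ge 2$ be an integer, let $w\ge 121d^2$ be a real number, let $0<\eta<\sqrt w/d$ be a real number, and let $a,b,c\in\mathbb F_q[T]$ be (pairwise) distinct non-constant polynomials. For $i\ge 1$ put $$m_i:=\left\lfloor\frac{\lfloor w^{i+1}\rfloor-\lfloor w^i-1\rfloor}{\lfloor\eta w^i\rfloor}\right\rfloor$$ (with $m_i:=0$ if $\lfloor\eta w^i\rfloor=0$). Let $(a_{n,w,\eta})_{n\ge 1}$ be the sequence given by $$a_{n,w,\eta}=\begin{cases} b & \text{if } n=\lfloor w^i\rfloor\text{ for some integer } i\ge 0,\\ c & \text{if } n\ne\lfloor w^i\rfloor\text{ for all integers } i\ge 0\text{ and } n=\lfloor w^j\rfloor+m\lfloor\eta w^j\rfloor\text{ for some integers } 1\le m\le m_j,\ j\ge 1,\\ a & \text{otherwise,}\end{cases}$$ and set $\xi_{w,\eta}:=[0,a_{1,w,\eta},a_{2,w,\eta},\ldots]$.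 Then the convergents of this continued fraction converge in $\mathbb F_q((T^{-1}))$, and for all integers $2\le n\le d$, $$w_n^*(\xi_{w,\eta})=\frac{2w-2-\eta}{2+\eta},\qquad w_n(\xi_{w,\eta})=\frac{2w-\eta}{2+\eta},$$ and hence $$w_n(\xi_{w,\eta})-w_n^*(\xi_{w,\eta})=\frac{2}{2+\eta}.$$ -/

import Mathlib

open Polynomial Filter Topology

noncomputable section

/-- The field `F((T⁻¹))` of Laurent series in `T⁻¹` over `F`. The variable of the underlying
`LaurentSeries F` plays the role of `T⁻¹`: the coefficient at `n : ℤ` is that of `T ^ (-n)`.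
It is a type synonym because the `F[X]`-algebra structure of `LaurentSeries F` sends `X` to the
variable, whereas here the polynomial variable `T` is its inverse. -/
def LaurentInf (F : Type*) [Field F] : Type _ := LaurentSeries F

namespace LaurentInf

variable {F : Type*} [Field F]

instance : Field (LaurentInf F) := inferInstanceAs (Field (LaurentSeries F))

/-- The embedding of `F[T]` into `F((T⁻¹))`; `T` is the Laurent series `1 • (T⁻¹) ^ (-1)`. -/
def ofPoly (F : Type*) [Field F] : F[X] →+* LaurentInf F :=
  Polynomial.eval₂RingHom (HahnSeries.C : F →+* LaurentSeries F)
    (HahnSeries.single (-1 : ℤ) (1 : F) : LaurentSeries F)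

instance : Algebra F[X] (LaurentInf F) := (ofPoly F).toAlgebra

/-- `|0| = 0`, and `|ξ| = q ^ (-N)` if `ξ = ∑_{n ≥ N} a_n T ^ (-n)` with `a_N ≠ 0`,
where `q` is the number of elements of `F`. -/
def absVal (ξ : LaurentInf F) : ℝ :=
  open Classical in
  if ξ = 0 then 0 else (Nat.card F : ℝ) ^ (-(HahnSeries.order (Γ := ℤ) (R := F) ξ))

theorem absVal_zero : absVal (0 : LaurentInf F) = 0 := by simp [absVal]

variable [Finite F]

theorem one_lt_card : (1 : ℝ) < (Nat.card F : ℝ) := by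
  exact_mod_cast Finite.one_lt_card

theorem absVal_pos {x : LaurentInf F} (hx : x ≠ 0) : 0 < absVal x := by
  have := one_lt_card (F := F)
  simp only [absVal, hx, if_false]
  positivity

theorem absVal_nonneg (x : LaurentInf F) : 0 ≤ absVal x := by
  by_cases hx : x = 0
  · simp [hx, absVal_zero]
  · exact (absVal_pos hx).le

theorem absVal_mul (x y : LaurentInf F) : absVal (x * y) = absVal x * absVal y := by
  by_cases hx : x = 0
  · simp [hx, absVal_zero]
  by_cases hy : y = 0
  · simp [hy, absVal_zero]
  have h0 : (Nat.card F : ℝ) ≠ 0 := (zero_lt_one.trans (one_lt_card (F := F))).ne'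
  have h : HahnSeries.order (Γ := ℤ) (R := F) (x * y)
      = HahnSeries.order (Γ := ℤ) (R := F) x + HahnSeries.order (Γ := ℤ) (R := F) y :=
    HahnSeries.order_mul (Γ := ℤ) (R := F) hx hy
  simp only [absVal, hx, hy, mul_ne_zero hx hy, if_false]
  rw [h, neg_add, zpow_add₀ h0]

theorem absVal_neg (x : LaurentInf F) : absVal (-x) = absVal x := by
  by_cases hx : x = 0
  · simp [hx]
  have h : HahnSeries.order (Γ := ℤ) (R := F) (-x) = HahnSeries.order (Γ := ℤ) (R := F) x :=
    HahnSeries.order_neg (Γ := ℤ) (R := F)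
  simp only [absVal, hx, neg_ne_zero.mpr hx, if_false]
  rw [h]

theorem absVal_add_le_max (x y : LaurentInf F) :
    absVal (x + y) ≤ max (absVal x) (absVal y) := by
  by_cases hx : x = 0
  · simp [hx]
  by_cases hy : y = 0
  · simp [hy]
  by_cases hxy : x + y = 0
  · rw [hxy, absVal_zero]; exact le_max_of_le_left (absVal_nonneg x)
  have h : min (HahnSeries.order (Γ := ℤ) (R := F) x) (HahnSeries.order (Γ := ℤ) (R := F) y)
      ≤ HahnSeries.order (Γ := ℤ) (R := F) (x + y) :=
    HahnSeries.min_order_le_order_add (Γ := ℤ) (R := F) hxy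
  simp only [absVal, hx, hy, hxy, if_false]
  rcases min_le_iff.mp h with h | h
  · exact le_max_of_le_left (zpow_le_zpow_right₀ (one_lt_card (F := F)).le (neg_le_neg h))
  · exact le_max_of_le_right (zpow_le_zpow_right₀ (one_lt_card (F := F)).le (neg_le_neg h))

theorem absVal_add_le (x y : LaurentInf F) : absVal (x + y) ≤ absVal x + absVal y :=
  (absVal_add_le_max x y).trans
    (max_le_add_of_nonneg (absVal_nonneg x) (absVal_nonneg y))

/-- `F((T⁻¹))` as a normed field, with the absolute value `absVal`. -/
instance : NormedField (LaurentInf F) where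
  norm := absVal
  dist x y := absVal (x - y)
  dist_eq x y := by
    change absVal (x - y) = absVal (-x + y)
    rw [← absVal_neg]
    congr 1
    ring
  dist_self x := by simp [absVal_zero]
  dist_comm x y := by rw [← absVal_neg]; congr 1; ring
  dist_triangle x y z := by
    have h : x - z = (x - y) + (y - z) := by ring
    rw [h]; exact absVal_add_le _ _
  eq_of_dist_eq_zero := by
    intro x y h
    by_contra hxy
    exact (absVal_pos (sub_ne_zero.mpr hxy)).ne' h
  norm_mul := absVal_mul

theorem norm_def (x : LaurentInf F) : ‖x‖ = absVal x := rfl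

/-- An algebraic closure of `F((T⁻¹))`; it contains an algebraic closure of `F(T)`. -/
abbrev Closure (F : Type*) [Field F] : Type _ := AlgebraicClosure (LaurentInf F)

/-- The unique extension of the absolute value of `F((T⁻¹))` to its algebraic closure. -/
def absClosure (α : Closure F) : ℝ := spectralNorm (LaurentInf F) (Closure F) α

/-- The height of `P ∈ (F[T])[X]`: the maximum of the absolute values of its coefficients. -/
def height (P : F[X][X]) : ℝ :=
  (P.support.sup fun i => ‖algebraMap F[X] (LaurentInf F) (P.coeff i)‖₊ : NNReal)

/-- `P ∈ (F[T])[X]` is the minimal polynomial of `α` : it is non-constant, irreducible, primitive,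
its leading coefficient is a monic polynomial in `T`, and `P(α) = 0`. Such a `P` exists if and only
if `α` is algebraic over `F(T)`, and it is then unique. -/
structure IsMinPoly (P : F[X][X]) (α : Closure F) : Prop where
  nonconst : 0 < P.natDegree
  irreducible : Irreducible P
  primitive : P.IsPrimitive
  monic : P.leadingCoeff.Monic
  root : aeval α P = 0

/-- The exponent `w_n(ξ)`, as an extended real number: the supremum of the real numbers `w` such
that `0 < |P(ξ)| ≤ H(P) ^ (-w)` for infinitely many `P ∈ (F[T])[X]` of degree at most `n`. -/
def wExp (n : ℕ) (ξ : LaurentInf F) : EReal :=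
  sSup {v : EReal | ∃ w : ℝ, v = (w : EReal) ∧
    {P : F[X][X] | P.natDegree ≤ n ∧ 0 < ‖aeval ξ P‖ ∧
      ‖aeval ξ P‖ ≤ height P ^ (-w)}.Infinite}

/-- The exponent `w_n^*(ξ)`, as an extended real number: the supremum of the real numbers `w` such
that `0 < |ξ - α| ≤ H(α) ^ (-w - 1)` for infinitely many `α` algebraic over `F(T)` of degree at
most `n`; degree and height of `α` are those of its minimal polynomial `P` over `F[T]`. -/
def wStarExp (n : ℕ) (ξ : LaurentInf F) : EReal :=
  sSup {v : EReal | ∃ w : ℝ, v = (w : EReal) ∧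
    {α : Closure F | ∃ P : F[X][X], IsMinPoly P α ∧ P.natDegree ≤ n ∧
      0 < absClosure (algebraMap (LaurentInf F) (Closure F) ξ - α) ∧
      absClosure (algebraMap (LaurentInf F) (Closure F) ξ - α) ≤ height P ^ (-w - 1)}.Infinite}

/-- The formal infinite continued fraction `[0, a 1, a 2, …]` with partial quotients `a n ∈ F[T]`
(the value `a 0` is not used). -/
def contFract (a : ℕ → F[X]) : GenContFract (LaurentInf F) where
  h := 0
  s := Stream'.Seq.ofStream fun k => ⟨1, algebraMap F[X] (LaurentInf F) (a (k + 1))⟩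

/-- `ξ = [0, a 1, a 2, …]`: the convergents of the continued fraction converge to `ξ` in
`F((T⁻¹))`. -/
def IsContFract (ξ : LaurentInf F) (a : ℕ → F[X]) : Prop :=
  Tendsto (fun n => (contFract a).convs n) atTop (𝓝 ξ)

end LaurentInf

/-- `m_i = ⌊(⌊w^(i+1)⌋ - ⌊w^i - 1⌋) / ⌊η w^i⌋⌋`, read as `0` if `⌊η w^i⌋ = 0`. -/
def blockCount (w η : ℝ) (i : ℕ) : ℤ :=
  ⌊((⌊w ^ (i + 1)⌋ - ⌊w ^ i - 1⌋ : ℤ) : ℝ) / ((⌊η * w ^ i⌋ : ℤ) : ℝ)⌋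

/-- The sequence `a_{n,w,η}` of partial quotients (used for `n ≥ 1`): `b` if `n = ⌊w^i⌋` for some
`i ≥ 0`; otherwise `c` if `n = ⌊w^j⌋ + m ⌊η w^j⌋` for some `j ≥ 1` and `1 ≤ m ≤ m_j`; otherwise
`a`. -/
def partialQuot {F : Type*} [Field F] (w η : ℝ) (a b c : F[X]) (n : ℕ) : F[X] :=
  open Classical in
  if ∃ i : ℕ, (n : ℤ) = ⌊w ^ i⌋ then b
  else if ∃ j : ℕ, 1 ≤ j ∧ ∃ m : ℤ, 1 ≤ m ∧ m ≤ blockCount w η j ∧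
      (n : ℤ) = ⌊w ^ j⌋ + m * ⌊η * w ^ j⌋ then c
  else a

end

/-! Write l = log|a| and let q_n be the denominators of the convergents of ξ. Partial quotients
other than a are so rare that log|q_n| = n l + O(j) for n ≤ ⌊w^(j+1)⌋
(`exists_abs_log_denNorm_sub_le`). Between ⌊w^j⌋ and e = ⌊w^(j+1)⌋ the partial quotients have period
k = ⌊ηw^j⌋, up to a possible defect next to ⌊w^j⌋. So ξ is very close to a quadratic number α_j, a
root of an explicit quadratic Q_j (`quad`) built from four convergents. With r within 1 of ⌊w^j⌋, up
to bounded shifts of indices and bounded factors, H(Q_j) is |q_r q_{r+k}|, |Q_j(ξ)| is 1/|q_e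
q_{e-k}| and |Q_j'(ξ)| is |q_{r+k}/q_r|. In units of l w^j, their logarithms tend to 2+η, -(2w-η)
and η (`exists_isQuadraticApprox`).

Lower bounds: the Q_j give w_n ≥ (2w-η)/(2+η). The root of Q_j nearest to ξ is at distance at most
|Q_j(ξ)|/|Q_j'(ξ)|, whose logarithm is about -2w in the same units, so w_n^* ≥ 2w/(2+η) - 1.

Upper bounds: heights are multiplicative (Gauss's lemma), so irreducible polynomials R of degree ≤ d
suffice. If R divides no Q_j, then Res(R, Q_j) is a nonzero polynomial in T, hence of absolute value
at least 1. With j chosen least so that the term containing Q_j(ξ) is too small to account for this,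
|R(ξ)| is bounded below (`norm_resultant_le`, `exists_bound_of_not_dvd`). The conditions w ≥ 121d²
and η < √w/d make the resulting exponent smaller than both claimed values
(`exists_exponent_between`). If R is linear, bounded partial quotients give |R(ξ)| ≫ 1/H(R). If R is
quadratic and divides Q_j, the cofactor divides c - a (`dvd_sub_of_C_dvd_quad`), so R is as good as
Q_j up to a constant. For w_n^*, |P(ξ)| ≤ H(P)|ξ - α| transfers the first two cases, and a Taylor
expansion at ξ handles the roots of Q_j. -/

noncomputable section

/-! ### Completeness of F((T⁻¹)) and its absolute values -/

namespace LaurentInf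

variable {F : Type*} [Field F]

/-- The coefficient of `T ^ (-n)` in a Laurent series in `T⁻¹`. -/
def coeff (x : LaurentInf F) (n : ℤ) : F := HahnSeries.coeff (Γ := ℤ) (R := F) x n

theorem coeff_sub (x y : LaurentInf F) (n : ℤ) : (x - y).coeff n = x.coeff n - y.coeff n :=
  HahnSeries.coeff_sub (Γ := ℤ) (R := F)

variable [Finite F]

instance : IsUltrametricDist (LaurentInf F) :=
  IsUltrametricDist.isUltrametricDist_of_isNonarchimedean_norm absVal_add_le_max

/-- Balls around 0 are coefficient conditions, so a Cauchy sequence is one whose coefficients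
stabilise; completeness is read off from this. -/
theorem norm_le_zpow_iff (x : LaurentInf F) (m : ℤ) :
    ‖x‖ ≤ (Nat.card F : ℝ) ^ (-m) ↔ ∀ n < m, x.coeff n = 0 := by
  have hq := one_lt_card (F := F)
  by_cases hx : x = 0
  · subst hx
    simp only [norm_zero]
    exact ⟨fun _ n _ => HahnSeries.coeff_zero (Γ := ℤ) (R := F), fun _ => by positivity⟩
  · have : ‖x‖ = (Nat.card F : ℝ) ^ (-(HahnSeries.order (Γ := ℤ) (R := F) x)) := by
      simp [norm_def, absVal, hx]
    rw [this, zpow_le_zpow_iff_right₀ hq, neg_le_neg_iff]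
    constructor
    · intro h n hn
      exact HahnSeries.coeff_eq_zero_of_lt_order (Γ := ℤ) (R := F) (hn.trans_le h)
    · intro h
      by_contra hlt
      exact HahnSeries.coeff_order_eq_zero.not.mpr hx (h _ (not_le.mp hlt))

instance : CompleteSpace (LaurentInf F) := by
  have hq := one_lt_card (F := F)
  have hq0 : (0 : ℝ) < Nat.card F := zero_lt_one.trans hq
  refine Metric.complete_of_cauchySeq_tendsto fun u hu => ?_
  have key : ∀ m : ℤ, ∃ N, ∀ k ≥ N, ∀ n < m, (u k).coeff n = (u N).coeff n := by
    intro m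
    obtain ⟨N, hN⟩ := Metric.cauchySeq_iff'.mp hu ((Nat.card F : ℝ) ^ (-m)) (by positivity)
    refine ⟨N, fun k hk n hn => ?_⟩
    have := (norm_le_zpow_iff (u k - u N) m).mp (by
      rw [← dist_eq_norm]; exact (hN k hk).le) n hn
    rwa [coeff_sub, sub_eq_zero] at this
  choose N hN using key
  -- `N m` fixes only the coefficients strictly below m, hence the index n + 1.
  let f : ℤ → F := fun n => (u (N (n + 1))).coeff n
  have hf : ∀ m : ℤ, ∀ k ≥ N m, ∀ n < m, (u k).coeff n = f n := by
    intro m k hk n hn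
    have h1 := hN m (max k (N (n + 1))) (hk.trans (le_max_left _ _)) n hn
    have h2 := hN (n + 1) (max k (N (n + 1))) (le_max_right _ _) n (by lia)
    have h3 := hN m k hk n hn
    rw [h3, ← h1, h2]
  have hsupp : BddBelow (Function.support f) := by
    refine ⟨min 0 (HahnSeries.order (Γ := ℤ) (R := F) (u (N 0))), fun n hn => ?_⟩
    by_contra hlt
    rw [not_le, lt_min_iff] at hlt
    refine hn ?_
    rw [← hf 0 _ le_rfl n hlt.1]
    exact HahnSeries.coeff_eq_zero_of_lt_order (Γ := ℤ) (R := F) hlt.2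
  let x : LaurentInf F := (HahnSeries.ofSuppBddBelow f hsupp : LaurentSeries F)
  have hx : ∀ n, x.coeff n = f n := fun n => rfl
  refine ⟨x, Metric.tendsto_atTop.mpr fun ε hε => ?_⟩
  obtain ⟨m, hm⟩ := exists_pow_lt_of_lt_one hε (inv_lt_one_of_one_lt₀ hq)
  refine ⟨N m, fun k hk => ?_⟩
  rw [dist_eq_norm]
  refine lt_of_le_of_lt ((norm_le_zpow_iff _ (m : ℤ)).mpr fun n hn => ?_) (b := _) (c := ε) ?_
  · rw [coeff_sub, hx, hf m k hk n hn, sub_self]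
  · simpa using hm

theorem norm_algebraMap_monomial (n : ℕ) {r : F} (hr : r ≠ 0) :
    ‖algebraMap F[X] (LaurentInf F) (monomial n r)‖ = (Nat.card F : ℝ) ^ n := by
  have h : algebraMap F[X] (LaurentInf F) (monomial n r)
      = (HahnSeries.single (-(n : ℤ)) r : LaurentSeries F) := by
    refine (eval₂_monomial (HahnSeries.C : F →+* LaurentSeries F)
      (HahnSeries.single (-1 : ℤ) (1 : F) : LaurentSeries F)).trans ?_
    rw [HahnSeries.single_pow, HahnSeries.C_apply, HahnSeries.single_mul_single]
    simp
  have h0 : (HahnSeries.single (-(n : ℤ)) r : LaurentSeries F) ≠ 0 := by simpa using hr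
  rw [h]
  refine (if_neg h0).trans ?_
  rw [HahnSeries.order_single hr, neg_neg, zpow_natCast]

theorem norm_algebraMap_lt {p : F[X]} {n : ℕ} (hp : p.degree < n) :
    ‖algebraMap F[X] (LaurentInf F) p‖ < (Nat.card F : ℝ) ^ n := by
  have hq := one_lt_card (F := F)
  rw [p.as_sum_support, map_sum]
  obtain ⟨i, hi, hle⟩ := IsUltrametricDist.exists_norm_finsetSum_le p.support
    fun i => algebraMap F[X] (LaurentInf F) (monomial i (p.coeff i))
  refine hle.trans_lt ?_
  rcases p.support.eq_empty_or_nonempty with h0 | h0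
  · rw [support_eq_empty] at h0
    subst h0
    simp only [coeff_zero, map_zero, norm_zero]
    positivity
  rw [norm_algebraMap_monomial _ (mem_support_iff.mp (hi h0))]
  exact pow_lt_pow_right₀ hq (by exact_mod_cast (le_degree_of_mem_supp i (hi h0)).trans_lt hp)

theorem norm_algebraMap {p : F[X]} (hp : p ≠ 0) :
    ‖algebraMap F[X] (LaurentInf F) p‖ = (Nat.card F : ℝ) ^ p.natDegree := by
  have h1 : ‖algebraMap F[X] (LaurentInf F) (monomial p.natDegree p.leadingCoeff)‖
      = (Nat.card F : ℝ) ^ p.natDegree :=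
    norm_algebraMap_monomial _ (leadingCoeff_ne_zero.mpr hp)
  have h2 : ‖algebraMap F[X] (LaurentInf F) p.eraseLead‖ < (Nat.card F : ℝ) ^ p.natDegree :=
    norm_algebraMap_lt ((degree_eraseLead_lt hp).trans_eq (degree_eq_natDegree hp))
  conv_lhs => rw [← p.eraseLead_add_monomial_natDegree_leadingCoeff, map_add]
  rw [IsUltrametricDist.norm_add_eq_max_of_norm_ne_norm (by rw [h1]; exact h2.ne), h1,
    max_eq_right h2.le]

theorem one_le_norm_algebraMap {p : F[X]} (hp : p ≠ 0) :
    1 ≤ ‖algebraMap F[X] (LaurentInf F) p‖ := by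
  rw [norm_algebraMap hp]; exact one_le_pow₀ (one_lt_card (F := F)).le

theorem algebraMap_injective : Function.Injective (algebraMap F[X] (LaurentInf F)) := by
  rw [injective_iff_map_eq_zero]
  intro p hp
  by_contra h
  have := one_le_norm_algebraMap h
  rw [hp, norm_zero] at this
  linarith

instance : FaithfulSMul F[X] (LaurentInf F) :=
  (faithfulSMul_iff_algebraMap_injective _ _).mpr algebraMap_injective

theorem norm_algebraMap_mono {p r : F[X]} (hr : r ≠ 0) (h : p.natDegree ≤ r.natDegree) :
    ‖algebraMap F[X] (LaurentInf F) p‖ ≤ ‖algebraMap F[X] (LaurentInf F) r‖ := by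
  by_cases hp : p = 0
  · simp [hp]
  · rw [norm_algebraMap hp, norm_algebraMap hr]
    exact pow_le_pow_right₀ (one_lt_card (F := F)).le h

/-- `F((T⁻¹))` as a nontrivially normed field. -/
abbrev nontriviallyNormedField : NontriviallyNormedField (LaurentInf F) where
  __ := (inferInstance : NormedField (LaurentInf F))
  non_trivial := ⟨algebraMap F[X] (LaurentInf F) X, by
    rw [norm_algebraMap X_ne_zero]; simpa using one_lt_card (F := F)⟩

/-- The spectral norm is multiplicative because the base field is complete, ultrametric and
nontrivially normed. -/
theorem absClosure_mul (x y : Closure F) : absClosure (x * y) = absClosure x * absClosure y := by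
  let := nontriviallyNormedField (F := F)
  exact spectralAlgNorm_mul (K := LaurentInf F) (L := Closure F) x y

theorem absClosure_algebraMap (x : LaurentInf F) :
    absClosure (algebraMap (LaurentInf F) (Closure F) x) = ‖x‖ :=
  spectralNorm_extends x

theorem absClosure_add_le_max (x y : Closure F) :
    absClosure (x + y) ≤ max (absClosure x) (absClosure y) :=
  isNonarchimedean_spectralNorm (K := LaurentInf F) (L := Closure F) x y

theorem absClosure_nonneg (x : Closure F) : 0 ≤ absClosure x := spectralNorm_nonneg x

theorem absClosure_pos {x : Closure F} (hx : x ≠ 0) : 0 < absClosure x :=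
  spectralNorm_zero_lt hx (Algebra.IsAlgebraic.isAlgebraic x)

theorem absClosure_neg (x : Closure F) : absClosure (-x) = absClosure x :=
  spectralNorm_neg (Algebra.IsAlgebraic.isAlgebraic x)

end LaurentInf
end

/-! ### Heights, resultants and distances to roots -/

noncomputable section

namespace LaurentInf

variable {F : Type*} [Field F] [Finite F]

theorem norm_coeff_le_height (P : F[X][X]) (i : ℕ) :
    ‖algebraMap F[X] (LaurentInf F) (P.coeff i)‖ ≤ height P := by
  by_cases hi : i ∈ P.support
  · exact_mod_cast Finset.le_sup (f := fun i => ‖algebraMap F[X] (LaurentInf F) (P.coeff i)‖₊) hi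
  · rw [notMem_support_iff.mp hi]
    simp [height]

theorem height_le {P : F[X][X]} {B : ℝ} (hB : 0 ≤ B)
    (h : ∀ i, ‖algebraMap F[X] (LaurentInf F) (P.coeff i)‖ ≤ B) : height P ≤ B := by
  lift B to NNReal using hB
  exact NNReal.coe_le_coe.mpr (Finset.sup_le fun i _ => h i)

theorem height_nonneg (P : F[X][X]) : 0 ≤ height P := NNReal.coe_nonneg _

theorem one_le_height {P : F[X][X]} (hP : P ≠ 0) : 1 ≤ height P :=
  (one_le_norm_algebraMap (leadingCoeff_ne_zero.mpr hP)).trans (norm_coeff_le_height P _)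

/-- The absolute value of `F((T⁻¹))` restricted to `F[T]`. -/
def polyAbs (F : Type*) [Field F] [Finite F] : AbsoluteValue F[X] ℝ :=
  (NormedField.toAbsoluteValue (LaurentInf F)).comp (algebraMap_injective (F := F))

theorem polyAbs_apply (p : F[X]) : polyAbs F p = ‖algebraMap F[X] (LaurentInf F) p‖ := rfl

theorem isNonarchimedean_polyAbs : IsNonarchimedean (polyAbs F) := fun x y => by
  simp only [polyAbs_apply, map_add]
  exact absVal_add_le_max _ _

/-- This identification makes Gauss's lemma available: the height is exactly multiplicative. -/
theorem height_eq_gaussNorm (P : F[X][X]) : height P = gaussNorm (polyAbs F) 1 P := by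
  refine le_antisymm (height_le (gaussNorm_nonneg _ _ zero_le_one) fun i => ?_) ?_
  · simpa [polyAbs_apply] using le_gaussNorm (polyAbs F) P zero_le_one i
  · obtain ⟨i, hi⟩ := exists_eq_gaussNorm (polyAbs F) 1 P
    rw [hi, one_pow, mul_one]
    exact norm_coeff_le_height P i

theorem height_mul (P Q : F[X][X]) : height (P * Q) = height P * height Q := by
  simp only [height_eq_gaussNorm]
  exact gaussNorm_mul isNonarchimedean_polyAbs zero_lt_one P Q

theorem height_C (r : F[X]) : height (C r) = ‖algebraMap F[X] (LaurentInf F) r‖ := by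
  rw [height_eq_gaussNorm, gaussNorm_C, polyAbs_apply]

theorem norm_aeval_le_height {ξ : LaurentInf F} (hξ : ‖ξ‖ ≤ 1) (P : F[X][X]) :
    ‖aeval ξ P‖ ≤ height P := by
  rw [aeval_eq_sum_range]
  refine IsUltrametricDist.norm_sum_le_of_forall_le_of_nonneg (height_nonneg P) fun i _ => ?_
  rw [Algebra.smul_def, norm_mul, norm_pow]
  exact (mul_le_of_le_one_right (norm_nonneg _) (pow_le_one₀ (norm_nonneg _) hξ)).trans
    (norm_coeff_le_height P i)

theorem finite_natDegree_le (N : ℕ) : {p : F[X] | p.natDegree ≤ N}.Finite := by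
  have : Finite (degreeLT F (N + 1)) := Finite.of_equiv _ (degreeLTEquiv F (N + 1)).toEquiv.symm
  refine Set.Finite.subset (Set.toFinite (degreeLT F (N + 1) : Set F[X])) fun p hp => ?_
  rw [SetLike.mem_coe, mem_degreeLT]
  exact (degree_le_natDegree.trans_lt (by exact_mod_cast Nat.lt_succ_of_le hp))

/-- Northcott's property: a height bound limits the degree in T of each coefficient, and F is
finite. -/
theorem finite_height_le (n : ℕ) (B : ℝ) :
    {P : F[X][X] | P.natDegree ≤ n ∧ height P ≤ B}.Finite := by
  have hq := one_lt_card (F := F)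
  obtain ⟨N, hN⟩ := pow_unbounded_of_one_lt B hq
  have hfin := finite_natDegree_le (F := F) N
  refine Set.Finite.of_finite_image (f := fun P : F[X][X] => fun i : Fin (n + 1) => P.coeff i)
    ((Set.Finite.pi fun _ : Fin (n + 1) => hfin).subset ?_) ?_
  · rintro _ ⟨P, ⟨-, hP⟩, rfl⟩ i -
    by_cases h0 : P.coeff i = 0
    · simp [h0]
    by_contra hlt
    have hlt' : N ≤ (P.coeff i).natDegree := by
      simp only [Set.mem_ofPred_eq, not_le] at hlt; exact hlt.le
    have h1 := norm_coeff_le_height P i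
    rw [norm_algebraMap h0] at h1
    have h2 := pow_le_pow_right₀ hq.le hlt'
    linarith
  · intro P hP Q hQ h
    ext1 i
    by_cases hi : i < n + 1
    · exact congrFun h ⟨i, hi⟩
    · rw [coeff_eq_zero_of_natDegree_lt (by have := hP.1; lia),
        coeff_eq_zero_of_natDegree_lt (by have := hQ.1; lia)]

theorem height_le_of_dvd {P Q : F[X][X]} (hQ : Q ≠ 0) (h : P ∣ Q) : height P ≤ height Q := by
  obtain ⟨R, rfl⟩ := h
  rw [height_mul]
  exact le_mul_of_one_le_right (height_nonneg P) (one_le_height (right_ne_zero_of_mul hQ))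

/-- A column of the Sylvester matrix lists the coefficients of a polynomial, shifted by k; pairing
it with the powers of x evaluates that polynomial. -/
theorem sum_pow_mul_shifted_coeff {R : Type*} [CommRing R] (x : R) {p : R[X]} {N k d : ℕ}
    (hd : p.natDegree ≤ d) (hk : k + d < N) :
    ∑ i : Fin N, x ^ (i : ℕ) * (if (i : ℕ) ∈ Set.Icc k (k + d) then p.coeff (i - k) else 0)
      = x ^ k * p.eval x := by
  rw [Fin.sum_univ_eq_sum_range
    (fun i => x ^ i * (if i ∈ Set.Icc k (k + d) then p.coeff (i - k) else 0)) N,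
    eval_eq_sum_range' (Nat.lt_succ_of_le hd), Finset.mul_sum]
  symm
  refine Finset.sum_of_injOn (fun i => k + i) (by simp [Set.InjOn]) ?_ ?_ ?_
  · intro i hi
    simp only [Finset.coe_range, Set.mem_Iio] at hi ⊢
    lia
  · intro i hi hi'
    rw [if_neg, mul_zero]
    rintro ⟨h1, h2⟩
    exact hi' ⟨i - k, by simp; lia, by simp; lia⟩
  · intro i hi
    have : i ≤ d := by simpa [Nat.lt_succ_iff] using hi
    rw [if_pos ⟨by lia, by lia⟩, Nat.add_sub_cancel_left]
    ring

/-- Adding ξ^k times row k to row 0 for k > 0 leaves the Sylvester determinant unchanged and turns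
row 0 into multiples of Q(ξ) and P(ξ) by powers of ξ. Each Leibniz term contains one entry of that
row, and the ultrametric inequality removes the sum over permutations. -/
theorem norm_resultant_le {ξ : LaurentInf F} (hξ : ‖ξ‖ ≤ 1) {P Q : F[X][X]} (hP : P ≠ 0)
    (hQ : Q ≠ 0) (hdeg : 0 < P.natDegree) :
    ‖algebraMap F[X] (LaurentInf F) (resultant P Q)‖ ≤
      height Q ^ P.natDegree * height P ^ Q.natDegree *
        max (‖aeval ξ Q‖ / height Q) (‖aeval ξ P‖ / height P) := by
  set m := P.natDegree
  set n := Q.natDegree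
  set φ := algebraMap F[X] (LaurentInf F)
  have hHP : 0 < height P := zero_lt_one.trans_le (one_le_height hP)
  have hHQ : 0 < height Q := zero_lt_one.trans_le (one_le_height hQ)
  rw [← resultant_map_map, resultant]
  set M := sylvester (P.map φ) (Q.map φ) m n with hM
  let z : Fin (m + n) := ⟨0, Nat.add_pos_left hdeg n⟩
  have hdet : M.det = (M.updateRow z (∑ k : Fin (m + n), ξ ^ (k : ℕ) • M k)).det := by
    rw [Matrix.det_updateRow_sum]
    simp [z]
  rw [hdet]
  set M' := M.updateRow z (∑ k : Fin (m + n), ξ ^ (k : ℕ) • M k) with hM'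
  -- Column bounds: the first m columns carry coefficients of Q, the last n those of P.
  let c : Fin (m + n) → ℝ := fun j => j.addCases (fun _ => height Q) (fun _ => height P)
  have hc0 : ∀ j, 0 < c j := fun j => Fin.addCases (fun k => by simp [c, hHQ])
    (fun k => by simp [c, hHP]) j
  have hM'c : ∀ i ≠ z, ∀ j, ‖M' i j‖ ≤ c j := by
    intro i hi j
    rw [hM', Matrix.updateRow_ne hi, hM]
    refine Fin.addCases (fun k => ?_) (fun k => ?_) j
    · simp only [sylvester, Matrix.of_apply, Fin.addCases_left, c]
      split_ifs
      · rw [coeff_map]; exact norm_coeff_le_height Q _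
      · rw [norm_zero]; exact hHQ.le
    · simp only [sylvester, Matrix.of_apply, Fin.addCases_right, c]
      split_ifs
      · rw [coeff_map]; exact norm_coeff_le_height P _
      · rw [norm_zero]; exact hHP.le
  set μ := max (‖aeval ξ Q‖ / height Q) (‖aeval ξ P‖ / height P) with hμ
  have hM'z : ∀ j, ‖M' z j‖ ≤ c j * μ := by
    intro j
    have h1 : M' z j = ∑ i : Fin (m + n), ξ ^ (i : ℕ) * M i j := by
      rw [hM', Matrix.updateRow_self, Finset.sum_apply]
      simp
    rw [h1, hM]
    refine Fin.addCases (fun k => ?_) (fun k => ?_) j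
    · simp only [sylvester, Matrix.of_apply, Fin.addCases_left, c]
      rw [sum_pow_mul_shifted_coeff ξ natDegree_map_le (by have := k.2; lia), norm_mul, norm_pow,
        eval_map_algebraMap]
      refine (mul_le_of_le_one_left (norm_nonneg _) (pow_le_one₀ (norm_nonneg _) hξ)).trans ?_
      rw [← div_le_iff₀' hHQ]
      exact le_max_left _ _
    · simp only [sylvester, Matrix.of_apply, Fin.addCases_right, c]
      rw [sum_pow_mul_shifted_coeff ξ natDegree_map_le (by have := k.2; lia), norm_mul, norm_pow,
        eval_map_algebraMap]
      refine (mul_le_of_le_one_left (norm_nonneg _) (pow_le_one₀ (norm_nonneg _) hξ)).trans ?_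
      rw [← div_le_iff₀' hHP]
      exact le_max_right _ _
  have hprod : ∏ j, c j = height Q ^ m * height P ^ n := by
    rw [Fin.prod_univ_add]
    simp [c]
  have hμ0 : 0 ≤ μ := le_max_of_le_left (div_nonneg (norm_nonneg _) hHQ.le)
  rw [← hprod, Matrix.det_apply]
  refine IsUltrametricDist.norm_sum_le_of_forall_le_of_nonneg
    (mul_nonneg (Finset.prod_nonneg fun j _ => (hc0 j).le) hμ0) fun σ _ => ?_
  have hsgn : ∀ x : LaurentInf F, ‖Equiv.Perm.sign σ • x‖ = ‖x‖ := by
    intro x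
    rcases Int.units_eq_one_or (Equiv.Perm.sign σ) with h | h <;> simp [h]
  rw [hsgn, norm_prod, ← Finset.mul_prod_erase _ _ (Finset.mem_univ (σ.symm z)),
    ← Finset.mul_prod_erase _ c (Finset.mem_univ (σ.symm z)), Equiv.apply_symm_apply,
    mul_right_comm]
  refine mul_le_mul (hM'z _) (Finset.prod_le_prod (fun _ _ => norm_nonneg _) fun j hj => ?_)
    (Finset.prod_nonneg fun _ _ => norm_nonneg _) (mul_nonneg (hc0 _).le hμ0)
  refine hM'c _ (fun h => ?_) _
  rw [Finset.mem_erase] at hj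
  exact hj.1 (by rw [← h, Equiv.symm_apply_apply])

/-- By Gauss's lemma irreducibility and divisibility pass to the fraction field, where a vanishing
resultant means a common factor. -/
theorem resultant_ne_zero_of_irreducible {P Q : F[X][X]} (hP : Irreducible P)
    (hdeg : 0 < P.natDegree) (h : ¬ P ∣ Q) : resultant P Q ≠ 0 := by
  have hprim : P.IsPrimitive := hP.isPrimitive hdeg.ne'
  let φ := algebraMap F[X] (FractionRing F[X])
  have hφ : Function.Injective φ := IsFractionRing.injective _ _
  intro h0
  have h1 : resultant (P.map φ) (Q.map φ) = 0 := by
    rw [natDegree_map_eq_of_injective hφ, natDegree_map_eq_of_injective hφ, resultant_map_map, h0,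
      map_zero]
  rw [resultant_eq_zero_iff] at h1
  have hirr : Irreducible (P.map φ) :=
    (hprim.irreducible_iff_irreducible_map_fraction_map (K := FractionRing F[X])).mp hP
  have hdvd : P.map φ ∣ Q.map φ := by
    by_contra hnd
    exact h1.2 ((hirr.coprime_iff_not_dvd).mpr hnd)
  exact h (IsPrimitive.dvd_of_fraction_map_dvd_fraction_map (K := FractionRing F[X]) hprim hdvd)

theorem absClosure_sum_le {ι : Type*} {s : Finset ι} {f : ι → Closure F} {B : ℝ} (hB : 0 ≤ B)
    (h : ∀ i ∈ s, absClosure (f i) ≤ B) : absClosure (∑ i ∈ s, f i) ≤ B := by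
  refine Finset.sum_induction f (fun x => absClosure x ≤ B)
    (fun x y hx hy => (absClosure_add_le_max x y).trans (max_le hx hy)) ?_ h
  simpa [absClosure, spectralNorm_zero] using hB

theorem absClosure_pow (x : Closure F) (n : ℕ) : absClosure (x ^ n) = absClosure x ^ n := by
  induction n with
  | zero => simpa using absClosure_algebraMap (1 : LaurentInf F)
  | succ n ih => rw [pow_succ, pow_succ, absClosure_mul, ih]

theorem absClosure_pow_sub_pow_le {x y : Closure F} (hx : absClosure x ≤ 1)
    (hy : absClosure y ≤ 1) (n : ℕ) : absClosure (x ^ n - y ^ n) ≤ absClosure (x - y) := by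
  induction n with
  | zero => simpa [absClosure, spectralNorm_zero] using absClosure_nonneg (x - y)
  | succ n ih =>
    have h : x ^ (n + 1) - y ^ (n + 1) = x * (x ^ n - y ^ n) + (x - y) * y ^ n := by ring
    rw [h]
    refine (absClosure_add_le_max _ _).trans (max_le ?_ ?_)
    · rw [absClosure_mul]
      exact (mul_le_of_le_one_left (absClosure_nonneg _) hx).trans ih
    · rw [absClosure_mul, absClosure_pow]
      exact mul_le_of_le_one_right (absClosure_nonneg _) (pow_le_one₀ (absClosure_nonneg _) hy)

/-- If |α| ≤ 1, compare P(ξ) with P(α) = 0 monomial by monomial. If |α| > 1 ≥ |ξ|, then |ξ - α| > 1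
and the trivial bound |P(ξ)| ≤ H(P) is enough. -/
theorem norm_aeval_le_height_mul {ξ : LaurentInf F} (hξ : ‖ξ‖ ≤ 1) {P : F[X][X]} {α : Closure F}
    (hα : aeval α P = 0) :
    ‖aeval ξ P‖ ≤ height P * absClosure (algebraMap (LaurentInf F) (Closure F) ξ - α) := by
  set x := algebraMap (LaurentInf F) (Closure F) ξ with hx
  have hx1 : absClosure x ≤ 1 := by rwa [hx, absClosure_algebraMap]
  by_cases hα1 : absClosure α ≤ 1
  · have h : algebraMap (LaurentInf F) (Closure F) (aeval ξ P)
        = ∑ i ∈ Finset.range (P.natDegree + 1), algebraMap F[X] (Closure F) (P.coeff i) *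
            (x ^ i - α ^ i) := by
      rw [← aeval_algebraMap_apply, ← hx, ← sub_zero (aeval x P), ← hα, aeval_eq_sum_range,
        aeval_eq_sum_range, ← Finset.sum_sub_distrib]
      simp_rw [Algebra.smul_def, mul_sub]
    rw [← absClosure_algebraMap, h]
    refine absClosure_sum_le (mul_nonneg (height_nonneg P) (absClosure_nonneg _)) fun i _ => ?_
    rw [absClosure_mul, IsScalarTower.algebraMap_apply F[X] (LaurentInf F) (Closure F),
      absClosure_algebraMap]
    exact mul_le_mul (norm_coeff_le_height P i) (absClosure_pow_sub_pow_le hx1 hα1 i)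
      (absClosure_nonneg _) (height_nonneg P)
  · refine (norm_aeval_le_height hξ P).trans (le_mul_of_one_le_right (height_nonneg P) ?_)
    rw [not_le] at hα1
    have h1 : α = x + -(x - α) := by ring
    have h2 := absClosure_add_le_max x (-(x - α))
    rw [← h1, absClosure_neg] at h2
    rcases le_max_iff.mp h2 with h | h <;> linarith

/-- The quadratic term uses the coefficient itself instead of half a second derivative, so
characteristic 2 is covered. -/
theorem aeval_eq_taylor_of_natDegree_le_two {R S : Type*} [CommRing R] [CommRing S] [Algebra R S]
    {Q : R[X]} (hQ : Q.natDegree ≤ 2) (x y : S) :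
    aeval y Q = aeval x Q + aeval x (derivative Q) * (y - x) +
      algebraMap R S (Q.coeff 2) * (y - x) ^ 2 := by
  rw [eq_quadratic_of_degree_le_two (natDegree_le_iff_degree_le.mp hQ)]
  simp
  ring

theorem norm_aeval_le_of_root_of_natDegree_le_two (ξ : LaurentInf F) {Q : F[X][X]}
    (hQ : Q.natDegree ≤ 2) {α : Closure F} (hα : aeval α Q = 0) :
    ‖aeval ξ Q‖ ≤ max
      (‖aeval ξ (derivative Q)‖ * absClosure (algebraMap (LaurentInf F) (Closure F) ξ - α))
      (height Q * absClosure (algebraMap (LaurentInf F) (Closure F) ξ - α) ^ 2) := by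
  set x := algebraMap (LaurentInf F) (Closure F) ξ with hx
  have h := aeval_eq_taylor_of_natDegree_le_two hQ x α
  rw [hα] at h
  have h' : algebraMap (LaurentInf F) (Closure F) (aeval ξ Q)
      = algebraMap (LaurentInf F) (Closure F) (aeval ξ (derivative Q)) * (x - α) +
        -(algebraMap (LaurentInf F) (Closure F) (algebraMap F[X] (LaurentInf F) (Q.coeff 2))
          * (x - α) ^ 2) := by
    rw [← aeval_algebraMap_apply, ← aeval_algebraMap_apply, ← hx,
      ← IsScalarTower.algebraMap_apply]
    linear_combination -h
  rw [← absClosure_algebraMap (aeval ξ Q), h']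
  refine (absClosure_add_le_max _ _).trans (max_le_max ?_ ?_)
  · rw [absClosure_mul, absClosure_algebraMap]
  · rw [absClosure_neg, absClosure_mul, absClosure_algebraMap, absClosure_pow]
    exact mul_le_mul_of_nonneg_right (norm_coeff_le_height Q 2) (pow_nonneg (absClosure_nonneg _) 2)

theorem algebraMap_closure_injective : Function.Injective (algebraMap F[X] (Closure F)) := by
  rw [IsScalarTower.algebraMap_eq F[X] (LaurentInf F) (Closure F)]
  exact (algebraMap (LaurentInf F) (Closure F)).injective.comp algebraMap_injective

/-- With leading coefficient A and roots α, β, Q(ξ) = A(ξ-α)(ξ-β) and Q'(ξ) = A((ξ-α)+(ξ-β)). The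
ultrametric inequality bounds the last sum by the larger of the two distances, so the nearer root
works. Nothing depends on separability. -/
theorem exists_root_of_natDegree_eq_two (ξ : LaurentInf F) {Q : F[X][X]} (hQ : Q.natDegree = 2) :
    ∃ α : Closure F, aeval α Q = 0 ∧
      absClosure (algebraMap (LaurentInf F) (Closure F) ξ - α) * ‖aeval ξ (derivative Q)‖
        ≤ ‖aeval ξ Q‖ := by
  set x := algebraMap (LaurentInf F) (Closure F) ξ with hx
  have hinj := algebraMap_closure_injective (F := F)
  obtain ⟨α, hα⟩ := IsAlgClosed.exists_aeval_eq_zero_of_injective (Closure F) hinj Q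
    (by rw [degree_eq_natDegree (by rintro rfl; simp at hQ), hQ]; norm_num)
  set A := algebraMap F[X] (Closure F) (Q.coeff 2) with hA
  have hA0 : A ≠ 0 := by
    rw [hA, map_ne_zero_iff _ hinj, ← hQ, coeff_natDegree, leadingCoeff_ne_zero]
    rintro rfl
    simp at hQ
  set D := aeval x (derivative Q) with hD
  set V := aeval x Q with hV
  have hDn : absClosure D = ‖aeval ξ (derivative Q)‖ := by
    rw [hD, hx, aeval_algebraMap_apply, absClosure_algebraMap]
  have hVn : absClosure V = ‖aeval ξ Q‖ := by
    rw [hV, hx, aeval_algebraMap_apply, absClosure_algebraMap]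
  have h1 := aeval_eq_taylor_of_natDegree_le_two hQ.le x α
  rw [hα, ← hA, ← hD, ← hV] at h1
  -- The second root is defined by the derivative identity; that it is a root is checked afterwards.
  obtain ⟨β, hβ'⟩ : ∃ β, A * (x - β) = D - A * (x - α) :=
    ⟨2 * x - α - D / A, by field_simp; ring⟩
  have h2 := aeval_eq_taylor_of_natDegree_le_two hQ.le x β
  rw [← hA, ← hD, ← hV] at h2
  have hβ : aeval β Q = 0 := by
    rw [h2]
    have : A * (β - x) = -D + A * (x - α) := by linear_combination -hβ'
    have h3 : A * (V + D * (β - x) + A * (β - x) ^ 2) = A * 0 := by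
      linear_combination (D + A * (β - x) + (-D + A * (x - α))) * this - A * h1
    exact mul_left_cancel₀ hA0 h3
  have hprod : V = A * ((x - α) * (x - β)) := by linear_combination -h1 - (x - α) * hβ'
  have hsum : D = A * ((x - α) + (x - β)) := by linear_combination -hβ'
  have key : ∀ y z : Closure F, V = A * (y * z) → D = A * (y + z) → absClosure y ≤ absClosure z →
      absClosure y * absClosure D ≤ absClosure V := by
    intro y z hV hD hyz
    rw [hV, hD, absClosure_mul, absClosure_mul, absClosure_mul, mul_left_comm]
    refine mul_le_mul_of_nonneg_left (mul_le_mul_of_nonneg_left ?_ (absClosure_nonneg _))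
      (absClosure_nonneg _)
    exact (absClosure_add_le_max y z).trans (max_le hyz le_rfl)
  rw [← hDn, ← hVn]
  rcases le_total (absClosure (x - α)) (absClosure (x - β)) with h | h
  · exact ⟨α, hα, key _ _ hprod hsum h⟩
  · exact ⟨β, hβ, key _ _ (hprod.trans (by ring)) (hsum.trans (by ring)) h⟩

/-- Some irreducible factor vanishes at α; primitivity follows from irreducibility, and a constant
from F normalises the leading coefficient. -/
theorem exists_isMinPoly_dvd {Q : F[X][X]} (hQ : Q ≠ 0) {α : Closure F} (hα : aeval α Q = 0) :
    ∃ P, IsMinPoly P α ∧ P ∣ Q := by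
  have h1 : ∃ P, Irreducible P ∧ P ∣ Q ∧ aeval α P = 0 := by
    induction Q using WfDvdMonoid.induction_on_irreducible with
    | zero => exact absurd rfl hQ
    | unit u hu => exact absurd hα (hu.map (aeval α)).ne_zero
    | mul a p ha hp ih =>
      rw [map_mul, mul_eq_zero] at hα
      rcases hα with h | h
      · exact ⟨p, hp, dvd_mul_right _ _, h⟩
      · obtain ⟨P, hP, hd, hP0⟩ := ih ha h
        exact ⟨P, hP, hd.mul_left _, hP0⟩
  obtain ⟨P, hP, hd, hP0⟩ := h1
  have hdeg : 0 < P.natDegree := by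
    by_contra h
    rw [Nat.pos_iff_ne_zero, not_not] at h
    rw [eq_C_of_natDegree_eq_zero h, aeval_C, map_eq_zero_iff _ algebraMap_closure_injective] at hP0
    rw [eq_C_of_natDegree_eq_zero h, hP0, C_0] at hP
    exact hP.ne_zero rfl
  set u := (P.leadingCoeff.leadingCoeff)⁻¹ with hu
  have hl0 : P.leadingCoeff.leadingCoeff ≠ 0 := by simpa using hP.ne_zero
  have hu0 : u ≠ 0 := inv_ne_zero hl0
  have hunit : IsUnit (C (C u) : F[X][X]) := by simpa [isUnit_C] using hu0
  have hirr : Irreducible (C (C u) * P) := (irreducible_isUnit_mul hunit).mpr hP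
  have hdeg' : 0 < (C (C u) * P).natDegree := by
    rwa [natDegree_C_mul (by simpa using hu0)]
  refine ⟨C (C u) * P, ⟨hdeg', hirr, hirr.isPrimitive hdeg'.ne', ?_, ?_⟩, ?_⟩
  · rw [Monic, leadingCoeff_mul, leadingCoeff_C, leadingCoeff_mul, leadingCoeff_C]
    exact inv_mul_cancel₀ hl0
  · rw [map_mul, hP0, mul_zero]
  · exact (hunit.mul_left_dvd).mpr hd

end LaurentInf
end

/-! ### Lower bounds derived from a sequence of quadratic approximations -/

noncomputable section

theorem exp_mul_rpow_neg_le {c v H r : ℝ} (hH : 0 < H) (hr : 0 < r)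
    (h : c - v * Real.log H ≤ Real.log r) : Real.exp c * H ^ (-v) ≤ r := by
  rw [Real.rpow_def_of_pos hH, ← Real.exp_add]
  rw [Real.le_log_iff_exp_le hr] at h
  convert h using 2
  ring

/-- Only v ≥ 0 has to be tested; the sign is needed when distances to roots are shown to tend to 0.
-/
theorem le_sSup_coe_of_forall_lt {S : Set EReal} {x : ℝ} (hx : 0 < x)
    (h : ∀ v : ℝ, 0 ≤ v → v < x → (v : EReal) ∈ S) : (x : EReal) ≤ sSup S := by
  refine le_of_forall_lt fun y hy => ?_
  obtain ⟨z, hz1, hz2⟩ := EReal.lt_iff_exists_real_btwn.mp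
    (max_lt hy (EReal.coe_lt_coe_iff.mpr hx))
  rw [max_lt_iff] at hz1
  exact hz1.1.trans_le (le_sSup (h z (EReal.coe_nonneg.mp hz1.2.le) (EReal.coe_lt_coe_iff.mp hz2)))

/-- The numerical inequality behind the hypotheses `w ≥ 121 d ^ 2` and `η < √w / d`. -/
theorem exists_exponent_between {d : ℕ} (hd : 2 ≤ d) {w η : ℝ} (hw : 121 * (d : ℝ) ^ 2 ≤ w)
    (hη0 : 0 < η) (hη : η < Real.sqrt w / d) :
    0 < (2 * w - η) - ((d : ℝ) - 1) * (2 + η) ∧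
    ∃ v : ℝ, 1 + 2 * ((d : ℝ) * (w * (2 + η))) / ((2 * w - η) - ((d : ℝ) - 1) * (2 + η)) < v ∧
      v < (2 * w - 2 - η) / (2 + η) := by
  have hd' : (2 : ℝ) ≤ d := by exact_mod_cast hd
  have hw0 : 0 ≤ w := le_trans (by positivity) hw
  set s := Real.sqrt w with hs
  have hsw : s ^ 2 = w := Real.sq_sqrt hw0
  have hs11 : 11 * (d : ℝ) ≤ s := Real.le_sqrt_of_sq_le (by linarith [mul_pow (11 : ℝ) d 2])
  rw [lt_div_iff₀ (by linarith)] at hη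
  set t := (d : ℝ) * (2 + η) with ht
  -- t = 2d + dη, where dη < s and 2d ≤ 2s/11.
  have ht1 : 11 * t < 13 * s := by rw [ht]; linarith
  have ht0 : 0 < t := by positivity
  have hut : 2 * (2 + η) ≤ t := mul_le_mul_of_nonneg_right hd' (by linarith)
  have hs22 : 22 ≤ s := by linarith
  -- The square of this inequality is the core of the final estimate, after 2(2+η) ≤ t.
  have hst : s * t < 2 * s ^ 2 - t := by nlinarith
  have hτeq : (2 * w - η) - ((d : ℝ) - 1) * (2 + η) = 2 * s ^ 2 + 2 - t := by rw [hsw, ht]; ring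
  rw [hτeq]
  have hst0 : 0 < s * t := by positivity
  have hτ : 0 < 2 * s ^ 2 + 2 - t := by linarith
  refine ⟨hτ, exists_between ?_⟩
  have hu : 0 < 2 + η := by linarith
  have h2 : 2 * ((d : ℝ) * (w * (2 + η))) / (2 * s ^ 2 + 2 - t) < (2 * w - 2 * (2 + η)) / (2 + η) := by
    rw [div_lt_div_iff₀ hτ hu]
    calc 2 * ((d : ℝ) * (w * (2 + η))) * (2 + η) = s ^ 2 * t * (2 * (2 + η)) := by
          rw [hsw, ht]; ring
      _ ≤ s ^ 2 * t * t := mul_le_mul_of_nonneg_left hut (by positivity)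
      _ = (s * t) * (s * t) := by ring
      _ < (2 * s ^ 2 - t) * (2 * s ^ 2 - t) :=
        mul_lt_mul'' hst hst hst0.le hst0.le
      _ ≤ (2 * w - 2 * (2 + η)) * (2 * s ^ 2 + 2 - t) :=
        mul_le_mul (by rw [hsw]; linarith) (by linarith) (by linarith) (by rw [← hsw]; linarith)
  have h3 : (2 * w - 2 - η) / (2 + η) = 1 + (2 * w - 2 * (2 + η)) / (2 + η) := by
    field_simp; ring
  rw [h3]
  linarith

namespace LaurentInf

variable {F : Type*} [Field F] [Finite F]

/-- A sequence of quadratic polynomials taking small values at `ξ`, with prescribed growth of the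
heights and prescribed decay of the values. -/
structure IsQuadraticApprox (w η κ : ℝ) (ξ : LaurentInf F) (Q : ℕ → F[X][X]) : Prop where
  norm_le : ‖ξ‖ ≤ 1
  natDegree_eq : ∀ j, (Q j).natDegree = 2
  aeval_ne_zero : ∀ j, aeval ξ (Q j) ≠ 0
  aeval_derivative_ne_zero : ∀ j, aeval ξ (derivative (Q j)) ≠ 0
  tendsto_height : Tendsto (fun j => Real.log (height (Q j)) / w ^ j) atTop (𝓝 (κ * (2 + η)))
  tendsto_aeval : Tendsto (fun j => Real.log ‖aeval ξ (Q j)‖ / w ^ j) atTop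
    (𝓝 (-(κ * (2 * w - η))))
  tendsto_aeval_derivative : Tendsto (fun j => Real.log ‖aeval ξ (derivative (Q j))‖ / w ^ j) atTop
    (𝓝 (κ * η))
  content_le : ∃ B : ℝ, ∀ j g, C g ∣ Q j → ‖algebraMap F[X] (LaurentInf F) g‖ ≤ B
  linear : ∃ c : ℝ, 0 < c ∧ ∀ R : F[X][X], R.natDegree = 1 → c / height R ≤ ‖aeval ξ R‖

theorem _root_.tendsto_atTop_of_tendsto_div_pow {w : ℝ} (hw : 1 < w) {f : ℕ → ℝ} {l : ℝ}
    (hl : 0 < l) (h : Tendsto (fun j => f j / w ^ j) atTop (𝓝 l)) : Tendsto f atTop atTop := by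
  have h1 := h.pos_mul_atTop hl (tendsto_pow_atTop_atTop_of_one_lt hw)
  refine h1.congr fun j => ?_
  have : w ^ j ≠ 0 := pow_ne_zero _ (by linarith)
  field_simp

namespace IsQuadraticApprox

variable {w η κ : ℝ} {ξ : LaurentInf F} {Q : ℕ → F[X][X]}

theorem ne_zero (h : IsQuadraticApprox w η κ ξ Q) (j : ℕ) : Q j ≠ 0 := by
  have := h.natDegree_eq j
  rintro h0
  simp [h0] at this

theorem height_pos (h : IsQuadraticApprox w η κ ξ Q) (j : ℕ) : 0 < height (Q j) :=
  zero_lt_one.trans_le (one_le_height (h.ne_zero j))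

theorem log_height_nonneg (h : IsQuadraticApprox w η κ ξ Q) (j : ℕ) :
    0 ≤ Real.log (height (Q j)) :=
  Real.log_nonneg (one_le_height (h.ne_zero j))

/-- `hlt` says H(R)² H(Q_j)^(d-1) |Q_j(ξ)| < 1. The resultant of R and Q_j has absolute value at
least 1, so in `norm_resultant_le` the maximum must come from R(ξ). -/
theorem log_le_of_not_dvd (h : IsQuadraticApprox w η κ ξ Q) {d j : ℕ} {R : F[X][X]}
    (hR : Irreducible R) (hR0 : 0 < R.natDegree) (hRd : R.natDegree ≤ d) (hdvd : ¬ R ∣ Q j)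
    (hlt : 2 * Real.log (height R) + (((d : ℝ) - 1) * Real.log (height (Q j)) +
      Real.log ‖aeval ξ (Q j)‖) < 0) :
    0 < ‖aeval ξ R‖ ∧
    -Real.log (height R) - d * Real.log (height (Q j)) ≤ Real.log ‖aeval ξ R‖ := by
  have h1 := (one_le_norm_algebraMap (resultant_ne_zero_of_irreducible hR hR0 hdvd)).trans
    (norm_resultant_le h.norm_le hR.ne_zero (h.ne_zero j) hR0)
  have hH := h.height_pos j
  have hHR : 0 < height R := zero_lt_one.trans_le (one_le_height hR.ne_zero)
  have hl := h.log_height_nonneg j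
  have hV : 0 < ‖aeval ξ (Q j)‖ := norm_pos_iff.mpr (h.aeval_ne_zero j)
  have hmd : (R.natDegree : ℝ) ≤ d := by exact_mod_cast hRd
  have hmul : (R.natDegree : ℝ) * Real.log (height (Q j)) ≤ d * Real.log (height (Q j)) :=
    mul_le_mul_of_nonneg_right hmd hl
  rw [h.natDegree_eq j, mul_max_of_nonneg _ _ (by positivity), le_max_iff] at h1
  rcases h1 with h1 | h1
  · exfalso
    have h2 := Real.log_nonneg h1
    rw [Real.log_mul (by positivity) (by positivity), Real.log_mul (by positivity) (by positivity),
      Real.log_div (by positivity) (by positivity), Real.log_pow, Real.log_pow] at h2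
    push_cast at h2
    linarith
  · have hr : 0 < ‖aeval ξ R‖ := by
      rw [norm_pos_iff]
      intro h0
      rw [h0, norm_zero, zero_div, mul_zero] at h1
      linarith
    refine ⟨hr, ?_⟩
    have h2 := Real.log_nonneg h1
    rw [Real.log_mul (by positivity) (by positivity), Real.log_mul (by positivity) (by positivity),
      Real.log_div (by positivity) (by positivity), Real.log_pow, Real.log_pow] at h2
    push_cast at h2
    linarith

theorem exists_bound_of_not_dvd (h : IsQuadraticApprox w η κ ξ Q) (hκ : 0 < κ) (hw : 1 < w)
    (hη : 0 < η) {d : ℕ} (hτ : 0 < (2 * w - η) - ((d : ℝ) - 1) * (2 + η)) {v : ℝ}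
    (hv : 1 + 2 * ((d : ℝ) * (w * (2 + η))) / ((2 * w - η) - ((d : ℝ) - 1) * (2 + η)) < v) :
    ∃ c : ℝ, 0 < c ∧ ∀ R : F[X][X], Irreducible R → 0 < R.natDegree → R.natDegree ≤ d →
      (∀ j, ¬ R ∣ Q j) → c * height R ^ (-v) ≤ ‖aeval ξ R‖ := by
  set τ := (2 * w - η) - ((d : ℝ) - 1) * (2 + η) with hτdef
  set l := fun j => Real.log (height (Q j)) with hl
  set f := fun j => -(((d : ℝ) - 1) * l j + Real.log ‖aeval ξ (Q j)‖) with hf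
  have hf_lim : Tendsto (fun j => f j / w ^ j) atTop (𝓝 (κ * τ)) := by
    have h1 := ((h.tendsto_height.const_mul ((d : ℝ) - 1)).add h.tendsto_aeval).neg
    have h2 : κ * τ = -(((d : ℝ) - 1) * (κ * (2 + η)) + -(κ * (2 * w - η))) := by
      rw [hτdef]; ring
    rw [h2]
    exact h1.congr fun j => by simp only [hf, hl]; ring
  have hl_lim : Tendsto (fun j => d * l (j + 1) / w ^ j) atTop (𝓝 (d * (w * (κ * (2 + η))))) := by
    have h1 := ((tendsto_add_atTop_iff_nat 1).mpr h.tendsto_height).const_mul ((d : ℝ) * w)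
    rw [mul_assoc] at h1
    refine h1.congr fun j => ?_
    have : w ^ j ≠ 0 := pow_ne_zero _ (by linarith)
    have : w ≠ 0 := by linarith
    simp only [hl]
    field_simp
    ring
  have hv1 : 1 ≤ v := by
    refine le_trans ?_ hv.le
    have : 0 ≤ 2 * ((d : ℝ) * (w * (2 + η))) / τ := by positivity
    linarith
  -- After passing to the limits this is exactly the lower bound assumed on v.
  have hev : ∀ᶠ j in atTop, d * l (j + 1) / w ^ j < (v - 1) / 2 * (f j / w ^ j) := by
    refine hl_lim.eventually_lt (hf_lim.const_mul ((v - 1) / 2)) ?_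
    have h1 : 2 * ((d : ℝ) * (w * (2 + η))) / τ < v - 1 := by linarith
    rw [div_lt_iff₀ hτ] at h1
    nlinarith
  obtain ⟨J, hJ⟩ := eventually_atTop.mp hev
  have hJ' : ∀ j ≥ J, d * l (j + 1) ≤ (v - 1) / 2 * f j := by
    intro j hj
    have h1 := hJ j hj
    have hwj : 0 < w ^ j := pow_pos (by linarith) _
    rw [← mul_div_assoc, div_lt_div_iff_of_pos_right hwj] at h1
    exact h1.le
  have hf_top : Tendsto f atTop atTop := tendsto_atTop_of_tendsto_div_pow hw (by positivity) hf_lim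
  refine ⟨Real.exp (-(d * l J)), Real.exp_pos _, fun R hR hR0 hRd hdvd => ?_⟩
  have hx : 0 ≤ Real.log (height R) := Real.log_nonneg (one_le_height hR.ne_zero)
  have hHR : 0 < height R := zero_lt_one.trans_le (one_le_height hR.ne_zero)
  have hlJ : 0 ≤ d * l J := mul_nonneg (by positivity) (h.log_height_nonneg J)
  have hex : ∃ j, J ≤ j ∧ 2 * Real.log (height R) < f j :=
    ((eventually_ge_atTop J).and (hf_top.eventually_gt_atTop _)).exists
  classical
  obtain ⟨hjJ, hjf⟩ := Nat.find_spec hex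
  have hmin := fun {m} => Nat.find_min hex (m := m)
  set j := Nat.find hex
  obtain ⟨hpos, hlog⟩ := h.log_le_of_not_dvd hR hR0 hRd (hdvd j) (by simp only [hf, hl] at hjf; linarith)
  refine exp_mul_rpow_neg_le hHR hpos ?_
  -- For j = J the loss is a constant. For j = i + 1, minimality gives f i ≤ 2 log H(R), so d log
  -- H(Q_j) ≤ (v-1)/2 · f i ≤ (v-1) log H(R).
  rcases hjJ.eq_or_lt with hj | hj
  · rw [← hj] at hlog
    have : Real.log (height R) ≤ v * Real.log (height R) := le_mul_of_one_le_left hx hv1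
    linarith
  · obtain ⟨i, hi⟩ : ∃ i, j = i + 1 := ⟨j - 1, by lia⟩
    have hi1 : ¬ (J ≤ i ∧ 2 * Real.log (height R) < f i) := hmin (by lia)
    have hiJ : J ≤ i := by lia
    have hi2 : f i ≤ 2 * Real.log (height R) := by
      by_contra hc
      exact hi1 ⟨hiJ, not_le.mp hc⟩
    have h1 := hJ' i hiJ
    have h2 : (v - 1) / 2 * f i ≤ (v - 1) / 2 * (2 * Real.log (height R)) :=
      mul_le_mul_of_nonneg_left hi2 (by linarith)
    rw [hi] at hlog
    linarith

/-- For such v, log|Q_j(ξ)| + v log H(Q_j) tends to infinity, so it is bounded below over all j; the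
constant factor g has bounded norm by `content_le`. -/
theorem exists_bound_of_dvd (h : IsQuadraticApprox w η κ ξ Q) (hκ : 0 < κ) (hw : 1 < w)
    (hη : 0 < η) {v : ℝ} (hv0 : 0 ≤ v) (hv : (2 * w - η) / (2 + η) < v) :
    ∃ c : ℝ, 0 < c ∧ ∀ j g R, Q j = R * C g → c * height R ^ (-v) ≤ ‖aeval ξ R‖ := by
  obtain ⟨B, hB⟩ := h.content_le
  have hlim : Tendsto (fun j => Real.log ‖aeval ξ (Q j)‖ + v * Real.log (height (Q j)))
      atTop atTop := by
    refine tendsto_atTop_of_tendsto_div_pow hw (l := κ * (v * (2 + η) - (2 * w - η))) ?_ ?_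
    · rw [div_lt_iff₀ (by linarith)] at hv
      exact mul_pos hκ (by linarith)
    · have h1 := h.tendsto_aeval.add (h.tendsto_height.const_mul v)
      rw [show κ * (v * (2 + η) - (2 * w - η)) = -(κ * (2 * w - η)) + v * (κ * (2 + η)) by ring]
      exact h1.congr fun j => by ring
  obtain ⟨c, hc⟩ := bddBelow_range_of_tendsto_atTop_atTop hlim
  refine ⟨Real.exp (c - (1 + v) * Real.log (max B 1)), Real.exp_pos _, fun j g R hR => ?_⟩
  have hRg : R * C g ≠ 0 := hR ▸ h.ne_zero j
  have hR0 : R ≠ 0 := left_ne_zero_of_mul hRg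
  have hg0 : g ≠ 0 := fun h0 => right_ne_zero_of_mul hRg (by rw [h0, C_0])
  have hgpos : 0 < ‖algebraMap F[X] (LaurentInf F) g‖ :=
    zero_lt_one.trans_le (one_le_norm_algebraMap hg0)
  have hHR : 0 < height R := zero_lt_one.trans_le (one_le_height hR0)
  have hV := h.aeval_ne_zero j
  have hc' : c ≤ _ := hc ⟨j, rfl⟩
  have hgB : Real.log ‖algebraMap F[X] (LaurentInf F) g‖ ≤ Real.log (max B 1) :=
    Real.log_le_log hgpos ((hB j g ⟨R, by rw [hR, mul_comm]⟩).trans (le_max_left _ _))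
  simp only [hR, map_mul, aeval_C, height_mul, height_C, norm_mul] at hc' hV
  have hr : 0 < ‖aeval ξ R‖ := norm_pos_iff.mpr (left_ne_zero_of_mul hV)
  rw [Real.log_mul hr.ne' hgpos.ne', Real.log_mul hHR.ne' hgpos.ne'] at hc'
  refine exp_mul_rpow_neg_le hHR hr ?_
  have := mul_le_mul_of_nonneg_left hgB (by linarith : 0 ≤ 1 + v)
  linarith

/-- Since Q_j(α) = 0, the expansion at ξ bounds |Q_j(ξ)| by its linear or its quadratic term; each
alternative bounds |ξ - α| from below. -/
theorem exists_bound_of_root (h : IsQuadraticApprox w η κ ξ Q) (hκ : 0 < κ) (hw : 1 < w)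
    (hη : 0 < η) {v : ℝ} (hv0 : 0 ≤ v) (hv : (2 * w - 2 - η) / (2 + η) < v) :
    ∃ c : ℝ, 0 < c ∧ ∀ j g R, Q j = R * C g → ∀ α : Closure F, aeval α R = 0 →
      c * height R ^ (-(v + 1)) ≤ absClosure (algebraMap (LaurentInf F) (Closure F) ξ - α) := by
  obtain ⟨B, hB⟩ := h.content_le
  have hv' : 2 * w < (v + 1) * (2 + η) := by
    rw [div_lt_iff₀ (by linarith)] at hv
    linarith
  have hlim1 : Tendsto (fun j => Real.log ‖aeval ξ (Q j)‖ -
      Real.log ‖aeval ξ (derivative (Q j))‖ + (v + 1) * Real.log (height (Q j))) atTop atTop := by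
    refine tendsto_atTop_of_tendsto_div_pow hw (l := κ * ((v + 1) * (2 + η) - 2 * w))
      (mul_pos hκ (by linarith)) ?_
    have h1 := (h.tendsto_aeval.sub h.tendsto_aeval_derivative).add
      (h.tendsto_height.const_mul (v + 1))
    rw [show κ * ((v + 1) * (2 + η) - 2 * w)
      = -(κ * (2 * w - η)) - κ * η + (v + 1) * (κ * (2 + η)) by ring]
    exact h1.congr fun j => by ring
  -- The quadratic alternative gives |ξ - α|² ≥ |Q_j(ξ)|/H(Q_j), with rate w + 1; this is less than
  -- 2w, the rate of the linear one.
  have hlim2 : Tendsto (fun j => (Real.log ‖aeval ξ (Q j)‖ - Real.log (height (Q j))) / 2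
      + (v + 1) * Real.log (height (Q j))) atTop atTop := by
    refine tendsto_atTop_of_tendsto_div_pow hw (l := κ * ((v + 1) * (2 + η) - (w + 1)))
      (mul_pos hκ (by linarith)) ?_
    have h1 := ((h.tendsto_aeval.sub h.tendsto_height).div_const 2).add
      (h.tendsto_height.const_mul (v + 1))
    rw [show κ * ((v + 1) * (2 + η) - (w + 1))
      = (-(κ * (2 * w - η)) - κ * (2 + η)) / 2 + (v + 1) * (κ * (2 + η)) by ring]
    exact h1.congr fun j => by ring
  obtain ⟨c₁, hc₁⟩ := bddBelow_range_of_tendsto_atTop_atTop hlim1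
  obtain ⟨c₂, hc₂⟩ := bddBelow_range_of_tendsto_atTop_atTop hlim2
  refine ⟨Real.exp (min c₁ c₂ - (v + 1) * Real.log (max B 1)), Real.exp_pos _,
    fun j g R hR α hα => ?_⟩
  have hRg : R * C g ≠ 0 := hR ▸ h.ne_zero j
  have hR0 : R ≠ 0 := left_ne_zero_of_mul hRg
  have hg0 : g ≠ 0 := fun h0 => right_ne_zero_of_mul hRg (by rw [h0, C_0])
  have hgpos : 0 < ‖algebraMap F[X] (LaurentInf F) g‖ :=
    zero_lt_one.trans_le (one_le_norm_algebraMap hg0)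
  have hHR : 0 < height R := zero_lt_one.trans_le (one_le_height hR0)
  have hH := h.height_pos j
  have hV : 0 < ‖aeval ξ (Q j)‖ := norm_pos_iff.mpr (h.aeval_ne_zero j)
  have hD : 0 < ‖aeval ξ (derivative (Q j))‖ := norm_pos_iff.mpr (h.aeval_derivative_ne_zero j)
  have hαQ : aeval α (Q j) = 0 := by rw [hR, map_mul, hα, zero_mul]
  have hgB : Real.log ‖algebraMap F[X] (LaurentInf F) g‖ ≤ Real.log (max B 1) :=
    Real.log_le_log hgpos ((hB j g ⟨R, by rw [hR, mul_comm]⟩).trans (le_max_left _ _))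
  have hroot := norm_aeval_le_of_root_of_natDegree_le_two ξ (h.natDegree_eq j).le hαQ
  have hne : algebraMap (LaurentInf F) (Closure F) ξ - α ≠ 0 := by
    intro h0
    rw [sub_eq_zero] at h0
    rw [← h0, aeval_algebraMap_apply] at hαQ
    exact h.aeval_ne_zero j ((map_eq_zero _).mp hαQ)
  have hY := absClosure_pos hne
  set Y := absClosure (algebraMap (LaurentInf F) (Closure F) ξ - α)
  have hc₁' : min c₁ c₂ ≤ _ := (min_le_left _ _).trans (hc₁ ⟨j, rfl⟩)
  have hc₂' : min c₁ c₂ ≤ _ := (min_le_right _ _).trans (hc₂ ⟨j, rfl⟩)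
  have hlogH : Real.log (height (Q j))
      = Real.log (height R) + Real.log ‖algebraMap F[X] (LaurentInf F) g‖ := by
    rw [hR, height_mul, height_C, Real.log_mul hHR.ne' hgpos.ne']
  refine exp_mul_rpow_neg_le hHR hY ?_
  have hmul := mul_le_mul_of_nonneg_left hgB (by linarith : 0 ≤ v + 1)
  have key : min c₁ c₂ - (v + 1) * Real.log (height (Q j)) ≤ Real.log Y := by
    rcases le_max_iff.mp hroot with h1 | h1
    · have h2 := Real.log_le_log hV h1
      rw [Real.log_mul hD.ne' hY.ne'] at h2
      simp only at hc₁'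
      linarith
    · have h2 := Real.log_le_log hV h1
      rw [Real.log_mul hH.ne' (pow_pos hY 2).ne', Real.log_pow] at h2
      push_cast at h2
      simp only at hc₂'
      linarith
  rw [hlogH] at key
  linarith

end IsQuadraticApprox

end LaurentInf
end

/-! ### From these bounds to the values of the exponents -/

noncomputable section

namespace LaurentInf

variable {F : Type*} [Field F] [Finite F]

theorem exists_lt_height_of_infinite {n : ℕ} {S : Set F[X][X]} (hS : S.Infinite)
    (hn : ∀ P ∈ S, P.natDegree ≤ n) (B : ℝ) : ∃ P ∈ S, B < height P := by
  by_contra! hB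
  exact hS ((finite_height_le n B).subset fun P hP => ⟨hn P hP, hB P hP⟩)

theorem rpow_height_mono {P : F[X][X]} (hP : P ≠ 0) {s t : ℝ} (h : s ≤ t) :
    height P ^ s ≤ height P ^ t :=
  Real.rpow_le_rpow_of_exponent_le (one_le_height hP) h

/-- If some v' > x were admissible, take v strictly between. By Northcott there are solutions of
arbitrarily large height, and H(P)^(v'-v) eventually exceeds 1/c. -/
theorem wExp_le {n : ℕ} {ξ : LaurentInf F} {x : ℝ}
    (h : ∀ v : ℝ, x < v → ∃ c : ℝ, 0 < c ∧ ∀ P : F[X][X], P ≠ 0 → P.natDegree ≤ n →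
      c * height P ^ (-v) ≤ ‖aeval ξ P‖) : wExp n ξ ≤ (x : EReal) := by
  refine sSup_le ?_
  rintro _ ⟨v', rfl, hinf⟩
  rw [EReal.coe_le_coe_iff]
  by_contra! hlt
  obtain ⟨v, hv1, hv2⟩ := exists_between hlt
  obtain ⟨c, hc, hP⟩ := h v hv1
  obtain ⟨P, ⟨hPn, hP0, hPv⟩, hPB⟩ := exists_lt_height_of_infinite hinf (fun P hP => hP.1)
    ((c⁻¹) ^ ((v' - v)⁻¹))
  have hPne : P ≠ 0 := by rintro rfl; simp at hP0
  have hH : 0 < height P := zero_lt_one.trans_le (one_le_height hPne)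
  have h1 := (hP P hPne hPn).trans hPv
  have h2 : c⁻¹ < height P ^ (v' - v) := by
    rwa [Real.rpow_inv_lt_iff_of_pos (by positivity) hH.le (by linarith)] at hPB
  rw [inv_lt_iff_one_lt_mul₀ hc] at h2
  have h3 : height P ^ (-v) = height P ^ (v' - v) * height P ^ (-v') := by
    rw [← Real.rpow_add hH]; congr 1; ring
  rw [h3, ← mul_assoc] at h1
  have h4 : 0 < height P ^ (-v') := Real.rpow_pos_of_pos hH _
  nlinarith

theorem wStarExp_le {n : ℕ} {ξ : LaurentInf F} {x : ℝ}
    (h : ∀ v : ℝ, x < v → ∃ c : ℝ, 0 < c ∧ ∀ (P : F[X][X]) (α : Closure F), IsMinPoly P α →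
      P.natDegree ≤ n → c * height P ^ (-(v + 1)) ≤
        absClosure (algebraMap (LaurentInf F) (Closure F) ξ - α)) :
    wStarExp n ξ ≤ (x : EReal) := by
  refine sSup_le ?_
  rintro _ ⟨v', rfl, hinf⟩
  rw [EReal.coe_le_coe_iff]
  by_contra! hlt
  obtain ⟨v, hv1, hv2⟩ := exists_between hlt
  obtain ⟨c, hc, hP⟩ := h v hv1
  refine hinf (Set.Finite.subset (Set.Finite.biUnion
    (finite_height_le (F := F) n ((c⁻¹) ^ ((v' - v)⁻¹)))
    fun P _ => (P.rootSet_finite (Closure F))) ?_)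
  rintro α ⟨P, hPα, hPn, hα0, hαv⟩
  have hPne : P ≠ 0 := hPα.irreducible.ne_zero
  have hH : 0 < height P := zero_lt_one.trans_le (one_le_height hPne)
  rw [Set.mem_iUnion₂]
  refine ⟨P, ⟨hPn, ?_⟩, ?_⟩
  · by_contra! hPB
    have h1 := (hP P α hPα hPn).trans hαv
    have h2 : c⁻¹ < height P ^ (v' - v) := by
      rwa [Real.rpow_inv_lt_iff_of_pos (by positivity) hH.le (by linarith)] at hPB
    rw [inv_lt_iff_one_lt_mul₀ hc] at h2
    have h3 : height P ^ (-(v + 1)) = height P ^ (v' - v) * height P ^ (-v' - 1) := by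
      rw [← Real.rpow_add hH]; congr 1; ring
    rw [h3, ← mul_assoc] at h1
    have h4 : 0 < height P ^ (-v' - 1) := Real.rpow_pos_of_pos hH _
    nlinarith
  · have hinj := algebraMap_closure_injective (F := F)
    rw [mem_rootSet']
    exact ⟨(Polynomial.map_ne_zero_iff hinj).mpr hPne, hPα.root⟩

/-- Both sides are multiplicative. Each nonconstant factor costs one c, and there are at most deg P
of them; constant factors cost nothing. -/
theorem exists_bound_of_forall_irreducible {ξ : LaurentInf F} {n : ℕ} {v c : ℝ} (hv : 0 ≤ v)
    (hc : 0 < c) (hc1 : c ≤ 1)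
    (h : ∀ R : F[X][X], Irreducible R → 0 < R.natDegree → R.natDegree ≤ n →
      c * height R ^ (-v) ≤ ‖aeval ξ R‖) {P : F[X][X]} (hP : P ≠ 0) (hPn : P.natDegree ≤ n) :
    c ^ P.natDegree * height P ^ (-v) ≤ ‖aeval ξ P‖ := by
  have hconst : ∀ P : F[X][X], P ≠ 0 → P.natDegree = 0 → height P ^ (-v) ≤ ‖aeval ξ P‖ := by
    intro P hP hP0
    obtain ⟨r, rfl⟩ : ∃ r, P = C r := ⟨_, eq_C_of_natDegree_eq_zero hP0⟩
    have h1 := one_le_height hP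
    rw [aeval_C, ← height_C]
    exact (Real.rpow_le_one_of_one_le_of_nonpos h1 (by linarith)).trans h1
  induction P using WfDvdMonoid.induction_on_irreducible with
  | zero => exact absurd rfl hP
  | unit u hu =>
    have h0 := natDegree_eq_zero_of_isUnit hu
    rw [h0, pow_zero, one_mul]
    exact hconst u hP h0
  | mul a p ha hp ih =>
    rw [natDegree_mul hp.ne_zero ha] at hPn ⊢
    have h1 := ih ha (by lia)
    have h2 : c ^ p.natDegree * height p ^ (-v) ≤ ‖aeval ξ p‖ := by
      rcases Nat.eq_zero_or_pos p.natDegree with h0 | h0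
      · rw [h0, pow_zero, one_mul]
        exact hconst p hp.ne_zero h0
      · refine le_trans ?_ (h p hp h0 (by lia))
        exact mul_le_mul_of_nonneg_right (pow_le_of_le_one hc.le hc1 h0.ne')
          (Real.rpow_nonneg (height_nonneg p) _)
    rw [map_mul, norm_mul, height_mul, Real.mul_rpow (height_nonneg _) (height_nonneg _), pow_add,
      mul_mul_mul_comm]
    exact mul_le_mul h2 h1 (mul_nonneg (pow_nonneg hc.le _)
      (Real.rpow_nonneg (height_nonneg a) _)) (norm_nonneg _)

namespace IsQuadraticApprox

variable {w η κ : ℝ} {ξ : LaurentInf F} {Q : ℕ → F[X][X]}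

theorem exists_eq_mul_C_of_dvd (h : IsQuadraticApprox w η κ ξ Q) {R : F[X][X]} {j : ℕ}
    (hR : 2 ≤ R.natDegree) (hdvd : R ∣ Q j) : ∃ g, Q j = R * C g := by
  obtain ⟨S, hS⟩ := hdvd
  have h0 := hS ▸ h.ne_zero j
  have h1 := h.natDegree_eq j
  rw [hS, natDegree_mul (left_ne_zero_of_mul h0) (right_ne_zero_of_mul h0)] at h1
  exact ⟨S.coeff 0, by rw [← eq_C_of_natDegree_eq_zero (by lia : S.natDegree = 0)]; exact hS⟩

theorem eventually_height_gt (h : IsQuadraticApprox w η κ ξ Q) (hκ : 0 < κ) (hw : 1 < w)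
    (hη : 0 < η) (B : ℝ) : ∀ᶠ j in atTop, B < height (Q j) := by
  have h1 := tendsto_atTop_of_tendsto_div_pow hw (by positivity) h.tendsto_height
  filter_upwards [h1.eventually_gt_atTop (Real.log (max B 1))] with j hj
  exact (le_max_left B 1).trans_lt
    ((Real.log_lt_log_iff (by positivity) (h.height_pos j)).mp hj)

theorem le_wExp (h : IsQuadraticApprox w η κ ξ Q) (hκ : 0 < κ) (hw : 1 < w) (hη : 0 < η)
    (hpos : 0 < (2 * w - η) / (2 + η)) {n : ℕ} (hn : 2 ≤ n) :
    (((2 * w - η) / (2 + η) : ℝ) : EReal) ≤ wExp n ξ := by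
  refine le_sSup_coe_of_forall_lt hpos fun v _ hv => ⟨v, rfl, ?_⟩
  rw [lt_div_iff₀ (by linarith)] at hv
  have hlim : Tendsto (fun j => -Real.log ‖aeval ξ (Q j)‖ - v * Real.log (height (Q j)))
      atTop atTop := by
    refine tendsto_atTop_of_tendsto_div_pow hw (l := κ * ((2 * w - η) - v * (2 + η)))
      (mul_pos hκ (by linarith)) ?_
    have h1 := h.tendsto_aeval.neg.sub (h.tendsto_height.const_mul v)
    rw [show κ * ((2 * w - η) - v * (2 + η)) = - -(κ * (2 * w - η)) - v * (κ * (2 + η)) by ring]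
    exact h1.congr fun j => by ring
  refine Set.Infinite.of_image height (Set.infinite_of_not_bddAbove ?_)
  rintro ⟨B, hB⟩
  obtain ⟨j, hj1, hj2⟩ :=
    ((h.eventually_height_gt hκ hw hη B).and (hlim.eventually_ge_atTop 0)).exists
  refine absurd (hB ⟨Q j, ⟨(h.natDegree_eq j).trans_le hn, ?_, ?_⟩, rfl⟩) (not_le.mpr hj1)
  · exact norm_pos_iff.mpr (h.aeval_ne_zero j)
  · rw [← Real.log_le_log_iff (norm_pos_iff.mpr (h.aeval_ne_zero j))
      (Real.rpow_pos_of_pos (h.height_pos j) _), Real.log_rpow (h.height_pos j)]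
    linarith

/-- The roots of Q_j nearest to ξ serve as approximations. Replacing Q_j by a minimal polynomial
dividing it only lowers the height, which weakens the requirement. Infinitely many roots occur
because their distances to ξ are positive and tend to 0. -/
theorem le_wStarExp (h : IsQuadraticApprox w η κ ξ Q) (hκ : 0 < κ) (hw : 1 < w) (hη : 0 < η)
    (hpos : 0 < (2 * w - 2 - η) / (2 + η)) {n : ℕ} (hn : 2 ≤ n) :
    (((2 * w - 2 - η) / (2 + η) : ℝ) : EReal) ≤ wStarExp n ξ := by
  refine le_sSup_coe_of_forall_lt hpos fun v hv0 hv => ⟨v, rfl, ?_⟩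
  rw [lt_div_iff₀ (by linarith)] at hv
  have hlim : Tendsto (fun j => Real.log ‖aeval ξ (derivative (Q j))‖ - Real.log ‖aeval ξ (Q j)‖
      - (v + 1) * Real.log (height (Q j))) atTop atTop := by
    refine tendsto_atTop_of_tendsto_div_pow hw (l := κ * (2 * w - (v + 1) * (2 + η)))
      (mul_pos hκ (by linarith)) ?_
    have h1 := (h.tendsto_aeval_derivative.sub h.tendsto_aeval).sub
      (h.tendsto_height.const_mul (v + 1))
    rw [show κ * (2 * w - (v + 1) * (2 + η))
      = κ * η - -(κ * (2 * w - η)) - (v + 1) * (κ * (2 + η)) by ring]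
    exact h1.congr fun j => by ring
  set x := algebraMap (LaurentInf F) (Closure F) ξ with hx
  refine Set.Infinite.of_image (fun α => (absClosure (x - α))⁻¹)
    (Set.infinite_of_not_bddAbove ?_)
  rintro ⟨B, hB⟩
  obtain ⟨j, hj1, hj2⟩ :=
    ((h.eventually_height_gt hκ hw hη B).and (hlim.eventually_ge_atTop 0)).exists
  obtain ⟨α, hα, hαξ⟩ := exists_root_of_natDegree_eq_two ξ (h.natDegree_eq j)
  obtain ⟨P, hP, hPd⟩ := exists_isMinPoly_dvd (h.ne_zero j) hα
  have hne : x - α ≠ 0 := by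
    intro h0
    rw [sub_eq_zero] at h0
    rw [← h0, hx, aeval_algebraMap_apply] at hα
    exact h.aeval_ne_zero j ((map_eq_zero _).mp hα)
  have hY := absClosure_pos hne
  have hD : 0 < ‖aeval ξ (derivative (Q j))‖ := norm_pos_iff.mpr (h.aeval_derivative_ne_zero j)
  have hle : absClosure (x - α) ≤ height (Q j) ^ (-v - 1) := by
    rw [← Real.log_le_log_iff hY (Real.rpow_pos_of_pos (h.height_pos j) _),
      Real.log_rpow (h.height_pos j)]
    have h1 := Real.log_le_log (mul_pos hY hD) hαξ
    rw [Real.log_mul hY.ne' hD.ne'] at h1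
    linarith
  refine absurd (hB ⟨α, ⟨P, hP, ?_, hY, hle.trans ?_⟩, rfl⟩) (not_le.mpr ?_)
  · exact (natDegree_le_of_dvd hPd (h.ne_zero j)).trans ((h.natDegree_eq j).trans_le hn)
  · exact Real.rpow_le_rpow_of_nonpos (zero_lt_one.trans_le (one_le_height hP.irreducible.ne_zero))
      (height_le_of_dvd (h.ne_zero j) hPd) (by linarith)
  · refine hj1.trans_le ?_
    rw [le_inv_comm₀ (h.height_pos j) hY]
    refine hle.trans ?_
    rw [← Real.rpow_neg_one]
    exact rpow_height_mono (h.ne_zero j) (by linarith)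

theorem exponents_eq (h : IsQuadraticApprox w η κ ξ Q) (hκ : 0 < κ) {d : ℕ} (hd : 2 ≤ d)
    (hw : 121 * (d : ℝ) ^ 2 ≤ w) (hη0 : 0 < η) (hη : η < Real.sqrt w / d) {n : ℕ} (hn : 2 ≤ n)
    (hnd : n ≤ d) :
    wExp n ξ = (((2 * w - η) / (2 + η) : ℝ) : EReal) ∧
      wStarExp n ξ = (((2 * w - 2 - η) / (2 + η) : ℝ) : EReal) := by
  have hw1 : 1 < w := by
    have hd' : (2 : ℝ) ≤ d := by exact_mod_cast hd
    nlinarith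
  obtain ⟨hτ, v₁, hv₁, hv₁'⟩ := exists_exponent_between hd hw hη0 hη
  obtain ⟨c₁, hc₁, hb₁⟩ := h.exists_bound_of_not_dvd hκ hw1 hη0 hτ hv₁
  obtain ⟨c₀, hc₀, hb₀⟩ := h.linear
  have hv1 : 1 < v₁ := by
    refine lt_of_le_of_lt ?_ hv₁
    have : 0 ≤ 2 * ((d : ℝ) * (w * (2 + η))) / ((2 * w - η) - ((d : ℝ) - 1) * (2 + η)) := by
      have : 0 < w := by linarith
      positivity
    linarith
  have hlt : (2 * w - 2 - η) / (2 + η) < (2 * w - η) / (2 + η) := by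
    rw [div_lt_div_iff_of_pos_right (by linarith)]
    linarith
  refine ⟨le_antisymm (wExp_le fun v hv => ?_) (h.le_wExp hκ hw1 hη0 (by linarith) hn),
    le_antisymm (wStarExp_le fun v hv => ?_) (h.le_wStarExp hκ hw1 hη0 (by linarith) hn)⟩
  · obtain ⟨c₂, hc₂, hb₂⟩ := h.exists_bound_of_dvd hκ hw1 hη0 (by linarith) hv
    set c := min 1 (min c₀ (min c₁ c₂)) with hc
    have hcpos : 0 < c := by positivity
    have hirr : ∀ R : F[X][X], Irreducible R → 0 < R.natDegree → R.natDegree ≤ n →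
        c * height R ^ (-v) ≤ ‖aeval ξ R‖ := by
      intro R hR hR0 hRn
      have hHR := one_le_height hR.ne_zero
      have hpow : 0 ≤ height R ^ (-v) := Real.rpow_nonneg (height_nonneg R) _
      by_cases hdvd : ∀ j, ¬ R ∣ Q j
      · refine le_trans ?_ (hb₁ R hR hR0 (hRn.trans hnd) hdvd)
        exact mul_le_mul ((min_le_right _ _).trans ((min_le_right _ _).trans (min_le_left _ _)))
          (rpow_height_mono hR.ne_zero (by linarith)) hpow hc₁.le
      by_cases hR1 : R.natDegree = 1
      · refine le_trans ?_ (hb₀ R hR1)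
        rw [div_eq_mul_inv, ← Real.rpow_neg_one]
        exact mul_le_mul ((min_le_right _ _).trans (min_le_left _ _))
          (rpow_height_mono hR.ne_zero (by linarith)) hpow hc₀.le
      · push Not at hdvd
        obtain ⟨j, hj⟩ := hdvd
        obtain ⟨g, hg⟩ := h.exists_eq_mul_C_of_dvd (by lia) hj
        refine le_trans ?_ (hb₂ j g R hg)
        exact mul_le_mul_of_nonneg_right
          ((min_le_right _ _).trans ((min_le_right _ _).trans (min_le_right _ _))) hpow
    refine ⟨c ^ n, pow_pos hcpos n, fun P hP hPn => le_trans ?_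
      (exists_bound_of_forall_irreducible (by linarith) hcpos (min_le_left _ _) hirr hP hPn)⟩
    exact mul_le_mul_of_nonneg_right (pow_le_pow_of_le_one hcpos.le (min_le_left _ _) hPn)
      (Real.rpow_nonneg (height_nonneg P) _)
  · obtain ⟨c₂, hc₂, hb₂⟩ := h.exists_bound_of_root hκ hw1 hη0 (by linarith) hv
    refine ⟨min c₀ (min c₁ c₂), by positivity, fun P α hP hPn => ?_⟩
    have hPne := hP.irreducible.ne_zero
    have hHP := one_le_height hPne
    have hHP0 : 0 < height P := by linarith
    have hpow : 0 ≤ height P ^ (-(v + 1)) := Real.rpow_nonneg (height_nonneg P) _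
    have hroot := norm_aeval_le_height_mul h.norm_le hP.root
    rw [← div_le_iff₀' hHP0] at hroot
    -- A lower bound for |P(ξ)| becomes one for |ξ - α| at the cost of one factor H(P).
    have hstep : ∀ {c s : ℝ}, 0 < c → s ≤ v → c * height P ^ (-s) ≤ ‖aeval ξ P‖ →
        c * height P ^ (-(v + 1)) ≤ absClosure (algebraMap (LaurentInf F) (Closure F) ξ - α) := by
      intro c s hc hs hle
      refine le_trans ?_ hroot
      rw [le_div_iff₀ hHP0]
      refine le_trans ?_ hle
      rw [mul_assoc]
      refine mul_le_mul_of_nonneg_left ?_ hc.le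
      rw [← Real.rpow_add_one hHP0.ne']
      exact rpow_height_mono hPne (by linarith)
    by_cases hdvd : ∀ j, ¬ P ∣ Q j
    · refine le_trans ?_ (hstep hc₁ (by linarith)
        (hb₁ P hP.irreducible hP.nonconst (hPn.trans hnd) hdvd))
      exact mul_le_mul_of_nonneg_right ((min_le_right _ _).trans (min_le_left _ _)) hpow
    by_cases hP1 : P.natDegree = 1
    · refine le_trans ?_ (hstep hc₀ (s := 1) (by linarith) ?_)
      · exact mul_le_mul_of_nonneg_right (min_le_left _ _) hpow
      · rw [Real.rpow_neg_one, ← div_eq_mul_inv]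
        exact hb₀ P hP1
    · push Not at hdvd
      obtain ⟨j, hj⟩ := hdvd
      have hP2 : 2 ≤ P.natDegree := by have := hP.nonconst; lia
      obtain ⟨g, hg⟩ := h.exists_eq_mul_C_of_dvd hP2 hj
      refine le_trans ?_ (hb₂ j g P hg α hP.root)
      exact mul_le_mul_of_nonneg_right ((min_le_right _ _).trans (min_le_right _ _)) hpow

end IsQuadraticApprox

end LaurentInf
end

noncomputable section

namespace LaurentInf

/-! ### Continuants and the quadratic attached to a periodic stretch -/

section Continuants

variable {R : Type*} [CommRing R]

/-- The solution of `y (n + 2) = a (n + 1) * y (n + 1) + y n` with given initial values. -/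
def continuant (a : ℕ → R) (y₀ y₁ : R) : ℕ → R
  | 0 => y₀
  | 1 => y₁
  | n + 2 => a (n + 1) * continuant a y₀ y₁ (n + 1) + continuant a y₀ y₁ n

/-- The denominators of the convergents: `den a (n + 1)` is that of the `n`-th convergent. -/
def den (a : ℕ → R) : ℕ → R := continuant a 0 1

/-- The numerators of the convergents: `num a (n + 1)` is that of the `n`-th convergent. -/
def num (a : ℕ → R) : ℕ → R := continuant a 1 0

theorem den_zero (a : ℕ → R) : den a 0 = 0 := rfl
theorem den_one (a : ℕ → R) : den a 1 = 1 := rfl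
theorem num_zero (a : ℕ → R) : num a 0 = 1 := rfl
theorem num_one (a : ℕ → R) : num a 1 = 0 := rfl

theorem den_add_two (a : ℕ → R) (n : ℕ) :
    den a (n + 2) = a (n + 1) * den a (n + 1) + den a n := rfl

theorem num_add_two (a : ℕ → R) (n : ℕ) :
    num a (n + 2) = a (n + 1) * num a (n + 1) + num a n := rfl

theorem num_mul_den_sub (a : ℕ → R) (n : ℕ) :
    num a (n + 1) * den a n - num a n * den a (n + 1) = (-1) ^ (n + 1) := by
  induction n with
  | zero => simp [num_zero, num_one, den_zero, den_one]
  | succ n ih => rw [num_add_two, den_add_two, pow_succ, ← ih]; ring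

theorem isCoprime_num_den (a : ℕ → R) (n : ℕ) : IsCoprime (num a n) (den a n) := by
  refine ⟨(-1) ^ n * den a (n + 1), -((-1) ^ n * num a (n + 1)), ?_⟩
  have h1 : ((-1 : R) ^ n) * (-1) ^ n = 1 := by rw [← mul_pow]; simp
  have h := num_mul_den_sub a n
  rw [pow_succ] at h
  linear_combination -(-1 : R) ^ n * h + h1

theorem isCoprime_den_succ (a : ℕ → R) (n : ℕ) : IsCoprime (den a (n + 1)) (den a n) := by
  refine ⟨(-1) ^ n * num a n, -((-1) ^ n * num a (n + 1)), ?_⟩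
  have h1 : ((-1 : R) ^ n) * (-1) ^ n = 1 := by rw [← mul_pow]; simp
  have h := num_mul_den_sub a n
  rw [pow_succ] at h
  linear_combination -(-1 : R) ^ n * h + h1

/-- The linear form `q X - p` attached to a convergent `p / q`. -/
def lin (a : ℕ → R) (n : ℕ) : R[X] := C (den a n) * X - C (num a n)

theorem lin_add_two (a : ℕ → R) (n : ℕ) :
    lin a (n + 2) = C (a (n + 1)) * lin a (n + 1) + lin a n := by
  simp only [lin, den_add_two, num_add_two, C_add, C_mul]
  ring

/-- The quadratic polynomial vanishing at the continued fraction whose partial quotients are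
`a 1, …, a r` followed by the period `a (r + 1), …, a (r + s)`. -/
def quad (a : ℕ → R) (r s : ℕ) : R[X] :=
  lin a r * lin a (r + 1 + s) - lin a (r + s) * lin a (r + 1)

/-- The recurrence is applied at both ends of the window. While the partial quotients repeat with
period s, shifting the window only changes the sign, so the polynomial can be studied at either end
of the periodic stretch. -/
theorem quad_succ (a : ℕ → R) (r s : ℕ) :
    quad a (r + 1) s = -quad a r s +
      C (a (r + 1 + s) - a (r + 1)) * (lin a (r + 1) * lin a (r + 1 + s)) := by
  have h : r + 1 + 1 + s = r + s + 2 := by ring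
  simp only [quad]
  rw [h, lin_add_two, lin_add_two, show r + s + 1 = r + 1 + s by ring, C_sub]
  ring

theorem quad_eq_or_neg (a : ℕ → R) {r s i : ℕ}
    (h : ∀ n, r < n → n ≤ r + i → a (n + s) = a n) :
    quad a (r + i) s = quad a r s ∨ quad a (r + i) s = -quad a r s := by
  induction i with
  | zero => left; rfl
  | succ i ih =>
    have h1 := quad_succ a (r + i) s
    rw [h (r + i + 1) (by lia) (by lia), sub_self, C_0, zero_mul, add_zero] at h1
    rw [← add_assoc, h1]
    rcases ih fun n hn hn' => h n hn (by lia) with h2 | h2 <;> rw [h2]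
    · right; rfl
    · left; rw [neg_neg]

theorem quad_eq_quadratic (a : ℕ → R) (r s : ℕ) :
    quad a r s = C (den a r * den a (r + 1 + s) - den a (r + s) * den a (r + 1)) * X ^ 2 +
      C (den a (r + s) * num a (r + 1) + num a (r + s) * den a (r + 1) -
        den a r * num a (r + 1 + s) - num a r * den a (r + 1 + s)) * X +
      C (num a r * num a (r + 1 + s) - num a (r + s) * num a (r + 1)) := by
  simp only [quad, lin, C_sub, C_add, C_mul]
  ring

theorem natDegree_quad_le (a : ℕ → R) (r s : ℕ) : (quad a r s).natDegree ≤ 2 := by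
  rw [quad_eq_quadratic]; exact natDegree_quadratic_le

theorem coeff_two_quad (a : ℕ → R) (r s : ℕ) :
    (quad a r s).coeff 2 = den a r * den a (r + 1 + s) - den a (r + s) * den a (r + 1) := by
  rw [quad_eq_quadratic]
  simp only [coeff_add, coeff_C_mul, coeff_X_pow, coeff_X, coeff_C]
  norm_num

/-- A common divisor of the coefficients divides every value of the associated binary form;
convergents will be substituted for (p, q). -/
theorem dvd_homogenization_quad {a : ℕ → R} {r s : ℕ} {g : R} (hg : C g ∣ quad a r s) (p q : R) :
    g ∣ (den a r * p - num a r * q) * (den a (r + 1 + s) * p - num a (r + 1 + s) * q) -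
      (den a (r + s) * p - num a (r + s) * q) * (den a (r + 1) * p - num a (r + 1) * q) := by
  rw [C_dvd_iff_dvd_coeff] at hg
  have h2 := hg 2
  have h1 := hg 1
  have h0 := hg 0
  rw [quad_eq_quadratic] at h0 h1 h2
  simp only [coeff_add, coeff_C_mul, coeff_X_pow, coeff_X, coeff_C] at h0 h1 h2
  norm_num at h0 h1 h2
  convert dvd_add (dvd_add (h2.mul_right (p ^ 2)) (h1.mul_right (p * q))) (h0.mul_right (q ^ 2))
    using 1
  ring

/-- Up to sign, the cross determinant of two convergents is the continuant of the partial quotients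
strictly between them, here all equal to x. -/
theorem cross_eq {a : ℕ → R} {r s : ℕ} {x : R} (h : ∀ i, 1 ≤ i → i < s → a (r + i) = x) :
    ∀ n ≤ s, den a (r + n) * num a r - num a (r + n) * den a r
      = (-1) ^ r * den (fun _ => x) n := by
  intro n
  induction n using Nat.strong_induction_on with
  | _ n ih =>
    intro hn
    match n, ih, hn with
    | 0, _, _ => simp [den_zero]; ring
    | 1, _, _ =>
      have := num_mul_den_sub a r
      rw [den_one]
      rw [pow_succ] at this
      linear_combination -this
    | n + 2, ih, hn =>
      have h1 := ih (n + 1) (by lia) (by lia)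
      have h2 := ih n (by lia) (by lia)
      rw [← add_assoc] at h1
      rw [← add_assoc, den_add_two, num_add_two, den_add_two (fun _ => x), add_assoc r n 1,
        h (n + 1) (by lia) (by lia), ← add_assoc]
      linear_combination x * h1 + h2

/-- Let K_n be the continuants of the constant sequence x. The form at two consecutive convergents
shows that g divides K_s and y K_{s-1} + K_{s-2}, hence (y - x) K_{s-1}; but K_s and K_{s-1} are
coprime. -/
theorem dvd_sub_of_C_dvd_quad [IsDomain R] {a : ℕ → R} {r s : ℕ} {x y g : R} (hs : 2 ≤ s)
    (h : ∀ i, 1 ≤ i → i < s → a (r + i) = x) (hy : a (r + s) = y) (hg : C g ∣ quad a r s) :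
    g ∣ y - x := by
  have hunit : ∀ n : ℕ, ((-1 : R) ^ n) * (-1) ^ n = 1 := fun n => by rw [← mul_pow]; simp
  obtain ⟨t, rfl⟩ : ∃ t, s = t + 2 := ⟨s - 2, by lia⟩
  have hw := num_mul_den_sub a r
  rw [pow_succ] at hw
  have h1 : g ∣ den (fun _ => x) (t + 2) := by
    have hc := cross_eq h (t + 2) le_rfl
    have hd := dvd_homogenization_quad hg (num a r) (den a r)
    have hV : den a (r + 1) * num a r - num a (r + 1) * den a r = (-1) ^ r := by
      linear_combination -hw
    rw [hc, hV] at hd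
    convert hd.mul_left (-1) using 1
    linear_combination -den (fun _ => x) (t + 2) * hunit r
  have hwin : ∀ i, 1 ≤ i → i < t + 1 → a (r + 1 + i) = x := fun i hi hi' => by
    rw [add_assoc]; exact h (1 + i) (by lia) (by lia)
  have hc1 := cross_eq hwin (t + 1) le_rfl
  have hc2 := cross_eq hwin t (by lia)
  have h2 : g ∣ y * den (fun _ => x) (t + 1) + den (fun _ => x) t := by
    have hd := dvd_homogenization_quad hg (num a (r + 1)) (den a (r + 1))
    have e1 : den a (r + 1 + (t + 2)) = y * den a (r + 1 + (t + 1)) + den a (r + 1 + t) := by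
      rw [← hy]; exact den_add_two a (r + 1 + t) |>.trans (by ring_nf)
    have e2 : num a (r + 1 + (t + 2)) = y * num a (r + 1 + (t + 1)) + num a (r + 1 + t) := by
      rw [← hy]; exact num_add_two a (r + 1 + t) |>.trans (by ring_nf)
    have hV : den a r * num a (r + 1) - num a r * den a (r + 1) = -(-1) ^ r := by
      linear_combination hw
    have hZ : (y * den a (r + 1 + (t + 1)) + den a (r + 1 + t)) * num a (r + 1) -
        (y * num a (r + 1 + (t + 1)) + num a (r + 1 + t)) * den a (r + 1) =
        -(-1) ^ r * (y * den (fun _ => x) (t + 1) + den (fun _ => x) t) := by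
      rw [pow_succ] at hc1 hc2
      linear_combination y * hc1 + hc2
    rw [e1, e2, hV, hZ] at hd
    convert hd using 1
    linear_combination -(y * den (fun _ => x) (t + 1) + den (fun _ => x) t) * hunit r
  have h3 : g ∣ (y - x) * den (fun _ => x) (t + 1) := by
    rw [den_add_two] at h1
    convert dvd_sub h2 h1 using 1
    ring
  have hcop : IsCoprime g (den (fun _ => x) (t + 1)) :=
    (isCoprime_den_succ (fun _ => x) (t + 1)).of_isCoprime_of_dvd_left h1
  exact hcop.dvd_of_dvd_mul_right h3

end Continuants

/-! ### Sizes of denominators, remainders and the quadratic polynomials -/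

section Norms

variable {F : Type*} [Field F] [Finite F] {a : ℕ → F[X]}

/-- A joint induction: growth makes the product term dominate the recurrence, and the resulting
product formula gives growth at the next index. -/
theorem norm_den_lt_and_norm_den_add_two (ha : ∀ n, 0 < (a (n + 1)).natDegree) (n : ℕ) :
    ‖algebraMap F[X] (LaurentInf F) (den a n)‖ < ‖algebraMap F[X] (LaurentInf F) (den a (n + 1))‖ ∧
    ‖algebraMap F[X] (LaurentInf F) (den a (n + 2))‖ = ‖algebraMap F[X] (LaurentInf F) (a (n + 1))‖ *
      ‖algebraMap F[X] (LaurentInf F) (den a (n + 1))‖ := by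
  have hq := one_lt_card (F := F)
  have ha1 : ∀ n, 1 < ‖algebraMap F[X] (LaurentInf F) (a (n + 1))‖ := fun n => by
    rw [norm_algebraMap (by rintro h; simpa [h] using ha n)]
    exact one_lt_pow₀ hq (ha n).ne'
  have step : ∀ n, ‖algebraMap F[X] (LaurentInf F) (den a n)‖ <
      ‖algebraMap F[X] (LaurentInf F) (den a (n + 1))‖ →
      ‖algebraMap F[X] (LaurentInf F) (den a (n + 2))‖ =
        ‖algebraMap F[X] (LaurentInf F) (a (n + 1))‖ *
          ‖algebraMap F[X] (LaurentInf F) (den a (n + 1))‖ := by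
    intro n hn
    have h1 : ‖algebraMap F[X] (LaurentInf F) (den a n)‖ <
        ‖algebraMap F[X] (LaurentInf F) (a (n + 1)) *
          algebraMap F[X] (LaurentInf F) (den a (n + 1))‖ := by
      rw [norm_mul]
      exact hn.trans_le (le_mul_of_one_le_left (norm_nonneg _) (ha1 n).le)
    rw [den_add_two, map_add, map_mul, IsUltrametricDist.norm_add_eq_max_of_norm_ne_norm h1.ne',
      max_eq_left h1.le, norm_mul]
  induction n with
  | zero =>
    have h0 : ‖algebraMap F[X] (LaurentInf F) (den a 0)‖ <
        ‖algebraMap F[X] (LaurentInf F) (den a (0 + 1))‖ := by simp [den_zero, den_one]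
    exact ⟨h0, step 0 h0⟩
  | succ n ih =>
    have h0 : ‖algebraMap F[X] (LaurentInf F) (den a (n + 1))‖ <
        ‖algebraMap F[X] (LaurentInf F) (den a (n + 1 + 1))‖ := by
      rw [ih.2]
      exact lt_mul_of_one_lt_left ((norm_nonneg _).trans_lt ih.1) (ha1 n)
    exact ⟨h0, step _ h0⟩

/-- The absolute value of the `n`-th denominator. -/
def denNorm (a : ℕ → F[X]) (n : ℕ) : ℝ := ‖algebraMap F[X] (LaurentInf F) (den a n)‖

theorem denNorm_def (a : ℕ → F[X]) (n : ℕ) :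
    denNorm a n = ‖algebraMap F[X] (LaurentInf F) (den a n)‖ := rfl

theorem strictMono_denNorm (ha : ∀ n, 0 < (a (n + 1)).natDegree) : StrictMono (denNorm a) :=
  strictMono_nat_of_lt_succ fun n => (norm_den_lt_and_norm_den_add_two ha n).1

theorem denNorm_add_two (ha : ∀ n, 0 < (a (n + 1)).natDegree) (n : ℕ) :
    denNorm a (n + 2) = ‖algebraMap F[X] (LaurentInf F) (a (n + 1))‖ * denNorm a (n + 1) :=
  (norm_den_lt_and_norm_den_add_two ha n).2

theorem denNorm_zero (a : ℕ → F[X]) : denNorm a 0 = 0 := by simp [denNorm, den_zero]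
theorem denNorm_one (a : ℕ → F[X]) : denNorm a 1 = 1 := by simp [denNorm, den_one]

theorem denNorm_pos (ha : ∀ n, 0 < (a (n + 1)).natDegree) {n : ℕ} (hn : 0 < n) :
    0 < denNorm a n := by
  rw [← denNorm_zero a]; exact strictMono_denNorm ha hn

theorem one_le_denNorm (ha : ∀ n, 0 < (a (n + 1)).natDegree) {n : ℕ} (hn : 0 < n) :
    1 ≤ denNorm a n := by
  rw [← denNorm_one a]; exact (strictMono_denNorm ha).monotone hn

theorem pow_le_denNorm (ha : ∀ n, 0 < (a (n + 1)).natDegree) (n : ℕ) :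
    (Nat.card F : ℝ) ^ n ≤ denNorm a (n + 1) := by
  have hq := one_lt_card (F := F)
  induction n with
  | zero => simp [denNorm_one]
  | succ n ih =>
    rw [denNorm_add_two ha, pow_succ']
    refine mul_le_mul ?_ ih (by positivity) (norm_nonneg _)
    rw [norm_algebraMap (by rintro h; simpa [h] using ha n)]
    exact le_self_pow₀ hq.le (ha n).ne'

omit [Finite F] in
theorem contsAux_contFract (a : ℕ → F[X]) (n : ℕ) :
    (contFract a).contsAux n = ⟨algebraMap F[X] (LaurentInf F) (num a n),
      algebraMap F[X] (LaurentInf F) (den a n)⟩ := by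
  induction n using Nat.strong_induction_on with
  | _ n ih =>
    match n, ih with
    | 0, _ => simp [GenContFract.contsAux, num_zero, den_zero]
    | 1, _ => simp [GenContFract.contsAux, contFract, num_one, den_one]
    | n + 2, ih =>
      rw [GenContFract.contsAux_recurrence (gp := ⟨1, algebraMap F[X] (LaurentInf F) (a (n + 1))⟩)
        rfl (ih n (by lia)) (ih (n + 1) (by lia)), num_add_two, den_add_two]
      simp

omit [Finite F] in
theorem convs_contFract (a : ℕ → F[X]) (n : ℕ) :
    (contFract a).convs n = algebraMap F[X] (LaurentInf F) (num a (n + 1)) /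
      algebraMap F[X] (LaurentInf F) (den a (n + 1)) := by
  simp only [GenContFract.convs, GenContFract.nums, GenContFract.dens, GenContFract.conts]
  simp [Stream'.map, Stream'.tail, Stream'.get, contsAux_contFract]

theorem norm_convs_succ_sub (ha : ∀ n, 0 < (a (n + 1)).natDegree) (n : ℕ) :
    ‖(contFract a).convs (n + 1) - (contFract a).convs n‖
      = (denNorm a (n + 1) * denNorm a (n + 2))⁻¹ := by
  have h1 : algebraMap F[X] (LaurentInf F) (den a (n + 1)) ≠ 0 :=
    norm_pos_iff.mp (denNorm_pos ha (by lia))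
  have h2 : algebraMap F[X] (LaurentInf F) (den a (n + 1 + 1)) ≠ 0 :=
    norm_pos_iff.mp (denNorm_pos ha (by lia))
  rw [convs_contFract, convs_contFract, div_sub_div _ _ h2 h1, norm_div, norm_mul, mul_comm
    ‖algebraMap F[X] (LaurentInf F) (den a (n + 1 + 1))‖, ← denNorm_def, ← denNorm_def,
    ← one_div]
  congr 1
  rw [mul_comm (algebraMap F[X] (LaurentInf F) (den a (n + 1 + 1))), ← map_mul, ← map_mul,
    ← map_sub, num_mul_den_sub]
  simp

theorem exists_isContFract (ha : ∀ n, 0 < (a (n + 1)).natDegree) : ∃ ξ, IsContFract ξ a := by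
  have hq := one_lt_card (F := F)
  have hq0 : (0 : ℝ) < Nat.card F := zero_lt_one.trans hq
  refine cauchySeq_tendsto_of_complete (cauchySeq_of_le_geometric (Nat.card F : ℝ)⁻¹ 1
    (inv_lt_one_of_one_lt₀ hq) fun n => ?_)
  rw [dist_comm, dist_eq_norm, norm_convs_succ_sub ha, one_mul, inv_pow]
  refine inv_anti₀ (by positivity) ((pow_le_denNorm ha n).trans ?_)
  exact le_mul_of_one_le_right (denNorm_pos ha (by lia)).le (one_le_denNorm ha (by lia))

/-- The value `q ξ - p` of the linear form attached to a convergent. -/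
def rem (a : ℕ → F[X]) (ξ : LaurentInf F) (n : ℕ) : LaurentInf F :=
  algebraMap F[X] (LaurentInf F) (den a n) * ξ - algebraMap F[X] (LaurentInf F) (num a n)

theorem norm_sub_convs_le (ha : ∀ n, 0 < (a (n + 1)).natDegree) {ξ : LaurentInf F}
    (hξ : IsContFract ξ a) (n : ℕ) :
    ‖ξ - (contFract a).convs n‖ ≤ (denNorm a (n + 1) * denNorm a (n + 2))⁻¹ := by
  have key : ∀ i, ‖(contFract a).convs (n + i) - (contFract a).convs n‖
      ≤ (denNorm a (n + 1) * denNorm a (n + 2))⁻¹ := by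
    intro i
    induction i with
    | zero =>
      rw [add_zero, sub_self, norm_zero]
      exact inv_nonneg.mpr (mul_nonneg (norm_nonneg _) (norm_nonneg _))
    | succ i ih =>
      rw [← sub_add_sub_cancel _ ((contFract a).convs (n + i))]
      refine (IsUltrametricDist.norm_add_le_max _ _).trans (max_le ?_ ih)
      rw [← add_assoc, norm_convs_succ_sub ha]
      refine inv_anti₀ (mul_pos (denNorm_pos ha (by lia)) (denNorm_pos ha (by lia))) ?_
      exact mul_le_mul ((strictMono_denNorm ha).monotone (by lia))
        ((strictMono_denNorm ha).monotone (by lia)) (norm_nonneg _) (norm_nonneg _)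
  have h1 : Tendsto (fun i => ‖(contFract a).convs (n + i) - (contFract a).convs n‖) atTop
      (𝓝 ‖ξ - (contFract a).convs n‖) := by
    have : Tendsto (fun i => (contFract a).convs (n + i)) atTop (𝓝 ξ) :=
      (hξ.comp (tendsto_add_atTop_nat n)).congr fun i => by simp [add_comm]
    exact (this.sub_const _).norm
  exact le_of_tendsto' h1 key

/-- The determinant identity gives rem_n q_{n+1} = ±1 + q_n rem_{n+1}, whose last term has norm
below 1 by convergence, so the left side has norm exactly 1. -/
theorem norm_rem (ha : ∀ n, 0 < (a (n + 1)).natDegree) {ξ : LaurentInf F}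
    (hξ : IsContFract ξ a) (n : ℕ) : ‖rem a ξ n‖ = (denNorm a (n + 1))⁻¹ := by
  have hle : ‖rem a ξ (n + 1)‖ ≤ (denNorm a (n + 2))⁻¹ := by
    have hd : algebraMap F[X] (LaurentInf F) (den a (n + 1)) ≠ 0 :=
      norm_pos_iff.mp (denNorm_pos ha (by lia))
    have h1 := norm_sub_convs_le ha hξ n
    rw [convs_contFract, mul_inv] at h1
    have h2 : rem a ξ (n + 1) = algebraMap F[X] (LaurentInf F) (den a (n + 1)) *
        (ξ - algebraMap F[X] (LaurentInf F) (num a (n + 1)) /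
          algebraMap F[X] (LaurentInf F) (den a (n + 1))) := by
      rw [rem]; field_simp
    have h3 := denNorm_pos ha (n := n + 1) (by lia)
    rw [h2, norm_mul, ← denNorm_def]
    refine (mul_le_mul_of_nonneg_left h1 h3.le).trans_eq ?_
    rw [← mul_assoc, mul_inv_cancel₀ h3.ne', one_mul]
  have hpos := denNorm_pos ha (n := n + 1) (by lia)
  have hlt : ‖algebraMap F[X] (LaurentInf F) (den a n) * rem a ξ (n + 1)‖ < 1 := by
    rw [norm_mul]
    refine (mul_le_mul_of_nonneg_left hle (norm_nonneg _)).trans_lt ?_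
    rw [← div_eq_mul_inv, div_lt_one (denNorm_pos ha (by lia))]
    exact strictMono_denNorm ha (by lia)
  have hid : rem a ξ n * algebraMap F[X] (LaurentInf F) (den a (n + 1)) = (-1) ^ (n + 1) +
      algebraMap F[X] (LaurentInf F) (den a n) * rem a ξ (n + 1) := by
    have := congrArg (algebraMap F[X] (LaurentInf F)) (num_mul_den_sub a n)
    simp only [map_sub, map_mul, map_pow, map_neg, map_one] at this
    rw [← this, rem, rem]
    ring
  have hone : ‖(-1 : LaurentInf F) ^ (n + 1)‖ = 1 := by simp
  have h3 : ‖rem a ξ n * algebraMap F[X] (LaurentInf F) (den a (n + 1))‖ = 1 := by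
    rw [hid, IsUltrametricDist.norm_add_eq_max_of_norm_ne_norm (by rw [hone]; exact hlt.ne'), hone,
      max_eq_left hlt.le]
  rw [norm_mul, ← denNorm_def] at h3
  exact eq_inv_of_mul_eq_one_left h3

omit [Finite F] in
theorem aeval_lin (a : ℕ → F[X]) (ξ : LaurentInf F) (n : ℕ) : aeval ξ (lin a n) = rem a ξ n := by
  simp [lin, rem]

theorem norm_rem_pos (ha : ∀ n, 0 < (a (n + 1)).natDegree) {ξ : LaurentInf F}
    (hξ : IsContFract ξ a) (n : ℕ) : 0 < ‖rem a ξ n‖ := by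
  rw [norm_rem ha hξ]; exact inv_pos.mpr (denNorm_pos ha (by lia))

theorem norm_rem_lt (ha : ∀ n, 0 < (a (n + 1)).natDegree) {ξ : LaurentInf F}
    (hξ : IsContFract ξ a) {m n : ℕ} (h : m < n) : ‖rem a ξ n‖ < ‖rem a ξ m‖ := by
  rw [norm_rem ha hξ, norm_rem ha hξ]
  exact inv_strictAnti₀ (denNorm_pos ha (by lia)) (strictMono_denNorm ha (by lia))

theorem norm_lt_one_of_isContFract (ha : ∀ n, 0 < (a (n + 1)).natDegree) {ξ : LaurentInf F}
    (hξ : IsContFract ξ a) : ‖ξ‖ < 1 := by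
  have h := norm_rem_lt ha hξ (zero_lt_one)
  simpa [rem, den_zero, den_one, num_zero, num_one] using h

omit [Finite F] in
theorem aeval_quad (a : ℕ → F[X]) (ξ : LaurentInf F) (r s : ℕ) : aeval ξ (quad a r s) =
    rem a ξ r * rem a ξ (r + 1 + s) - rem a ξ (r + s) * rem a ξ (r + 1) := by
  simp [quad, aeval_lin]

theorem norm_eq_of_norm_sub_lt {x y : LaurentInf F} (h : ‖x - y‖ < ‖y‖) : ‖x‖ = ‖y‖ := by
  have h1 : x = y + (x - y) := by ring
  rw [h1, IsUltrametricDist.norm_add_eq_max_of_norm_ne_norm h.ne', max_eq_left h.le]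

theorem norm_sub_lt {x y : LaurentInf F} {B : ℝ} (hx : ‖x‖ < B) (hy : ‖y‖ < B) : ‖x - y‖ < B := by
  rw [sub_eq_add_neg]
  exact (IsUltrametricDist.norm_add_le_max _ _).trans_lt (max_lt hx (by rwa [norm_neg]))

/-- At the place where periodicity breaks, the correction term of `quad_succ` strictly dominates the
value of the shifted quadratic and therefore determines the norm. -/
theorem norm_aeval_quad (ha : ∀ n, 0 < (a (n + 1)).natDegree) {ξ : LaurentInf F}
    (hξ : IsContFract ξ a) {i s : ℕ} (hne : a (i + 1 + s) ≠ a (i + 1)) :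
    ‖aeval ξ (quad a i s)‖ =
      ‖algebraMap F[X] (LaurentInf F) (a (i + 1 + s) - a (i + 1))‖ *
        ((denNorm a (i + 2))⁻¹ * (denNorm a (i + 2 + s))⁻¹) := by
  set δ := algebraMap F[X] (LaurentInf F) (a (i + 1 + s) - a (i + 1)) with hδ
  have hδ1 : 1 ≤ ‖δ‖ := one_le_norm_algebraMap (sub_ne_zero.mpr hne)
  have h1 : aeval ξ (quad a (i + 1) s) = -aeval ξ (quad a i s) +
      δ * (rem a ξ (i + 1) * rem a ξ (i + 1 + s)) := by
    rw [quad_succ]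
    simp [aeval_lin, hδ]
  have hnorm : ‖δ * (rem a ξ (i + 1) * rem a ξ (i + 1 + s))‖ =
      ‖δ‖ * ((denNorm a (i + 2))⁻¹ * (denNorm a (i + 2 + s))⁻¹) := by
    rw [norm_mul, norm_mul, norm_rem ha hξ, norm_rem ha hξ, add_right_comm (i + 1) s 1]
  have hlt : ‖aeval ξ (quad a (i + 1) s)‖ < ‖rem a ξ (i + 1) * rem a ξ (i + 1 + s)‖ := by
    rw [aeval_quad]
    refine norm_sub_lt ?_ ?_
    · rw [norm_mul, norm_mul]
      exact mul_lt_mul_of_pos_left (norm_rem_lt ha hξ (by lia)) (norm_rem_pos ha hξ _)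
    · rw [norm_mul, norm_mul, mul_comm ‖rem a ξ (i + 1)‖]
      exact mul_lt_mul_of_pos_left (norm_rem_lt ha hξ (by lia)) (norm_rem_pos ha hξ _)
  rw [← hnorm]
  refine norm_eq_of_norm_sub_lt ?_
  have h2 : aeval ξ (quad a i s) - δ * (rem a ξ (i + 1) * rem a ξ (i + 1 + s))
      = -aeval ξ (quad a (i + 1) s) := by rw [h1]; ring
  rw [h2, norm_neg]
  refine hlt.trans_le ?_
  rw [norm_mul δ]
  exact le_mul_of_one_le_left (norm_nonneg _) hδ1

/-- Of the four products in the derivative, the largest denominator times the largest remainder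
strictly dominates. -/
theorem norm_aeval_derivative_quad (ha : ∀ n, 0 < (a (n + 1)).natDegree) {ξ : LaurentInf F}
    (hξ : IsContFract ξ a) (r : ℕ) {s : ℕ} (hs : 0 < s) :
    ‖aeval ξ (derivative (quad a r s))‖ = denNorm a (r + 1 + s) * (denNorm a (r + 1))⁻¹ := by
  have hder : aeval ξ (derivative (quad a r s)) =
      algebraMap F[X] (LaurentInf F) (den a (r + 1 + s)) * rem a ξ r +
      ((algebraMap F[X] (LaurentInf F) (den a r) * rem a ξ (r + 1 + s) -
        algebraMap F[X] (LaurentInf F) (den a (r + 1)) * rem a ξ (r + s)) -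
        algebraMap F[X] (LaurentInf F) (den a (r + s)) * rem a ξ (r + 1)) := by
    simp only [quad, derivative_mul, map_sub, map_add, map_mul, aeval_lin]
    simp [lin]
    ring
  have hmono := strictMono_denNorm ha
  have hpos := fun n => denNorm_pos ha (n := n + 1) (by lia)
  have hnorm : ∀ m n, ‖algebraMap F[X] (LaurentInf F) (den a m) * rem a ξ n‖ =
      denNorm a m * (denNorm a (n + 1))⁻¹ := fun m n => by
    rw [norm_mul, norm_rem ha hξ]; rfl
  have hmain : 1 < denNorm a (r + 1 + s) * (denNorm a (r + 1))⁻¹ := by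
    rw [← div_eq_mul_inv, one_lt_div (hpos r)]
    exact hmono (by lia)
  rw [← hnorm]
  refine norm_eq_of_norm_sub_lt ?_
  rw [hder, add_sub_cancel_left, hnorm]
  refine norm_sub_lt (norm_sub_lt ?_ ?_) ?_
  · refine lt_of_le_of_lt ?_ hmain
    rw [hnorm, ← div_eq_mul_inv, div_le_one (hpos _)]
    exact hmono.monotone (by lia)
  · refine lt_of_le_of_lt ?_ hmain
    rw [hnorm, ← div_eq_mul_inv, div_le_one (hpos _)]
    exact hmono.monotone (by lia)
  · rw [hnorm]
    exact mul_lt_mul'' (hmono (by lia)) (inv_strictAnti₀ (hpos _) (hmono (by lia)))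
      (norm_nonneg _) (inv_pos.mpr (hpos _)).le

/-- The counterpart at the start of the stretch: the mismatch just before the period makes the
correction term dominate, so no cancellation lowers the height. -/
theorem norm_coeff_two_quad (ha : ∀ n, 0 < (a (n + 1)).natDegree) {r s : ℕ}
    (hne : a (r + 1 + s) ≠ a (r + 1)) :
    ‖algebraMap F[X] (LaurentInf F) ((quad a (r + 1) s).coeff 2)‖ =
      ‖algebraMap F[X] (LaurentInf F) (a (r + 1 + s) - a (r + 1))‖ *
        (denNorm a (r + 1) * denNorm a (r + 1 + s)) := by
  set φ := algebraMap F[X] (LaurentInf F) with hφ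
  have hδ1 : 1 ≤ ‖φ (a (r + 1 + s) - a (r + 1))‖ := one_le_norm_algebraMap (sub_ne_zero.mpr hne)
  have hmono := strictMono_denNorm ha
  have h1 : φ ((quad a (r + 1) s).coeff 2) - φ (a (r + 1 + s) - a (r + 1)) *
      (φ (den a (r + 1)) * φ (den a (r + 1 + s))) =
      φ (den a (r + s)) * φ (den a (r + 1)) - φ (den a r) * φ (den a (r + 1 + s)) := by
    have h := congrArg (fun P => φ (Polynomial.coeff P 2)) (quad_succ a r s)
    simp only [coeff_add, coeff_neg, coeff_C_mul, map_add, map_neg, map_mul] at h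
    have h2 : (lin a (r + 1) * lin a (r + 1 + s)).coeff 2 = den a (r + 1) * den a (r + 1 + s) := by
      have : lin a (r + 1) * lin a (r + 1 + s) = C (den a (r + 1) * den a (r + 1 + s)) * X ^ 2 +
          C (-(den a (r + 1) * num a (r + 1 + s) + num a (r + 1) * den a (r + 1 + s))) * X +
          C (num a (r + 1) * num a (r + 1 + s)) := by
        simp only [lin, C_neg, C_add, C_mul]; ring
      rw [this]
      simp only [coeff_add, coeff_C_mul, coeff_X_pow, coeff_X, coeff_C]
      norm_num
    rw [h2, coeff_two_quad a r s, map_sub, map_mul, map_mul, map_mul] at h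
    rw [h]; ring
  rw [denNorm_def, denNorm_def, ← norm_mul, ← norm_mul]
  refine norm_eq_of_norm_sub_lt ?_
  rw [h1, norm_mul]
  refine lt_of_lt_of_le ?_ (le_mul_of_one_le_left (norm_nonneg _) hδ1)
  refine norm_sub_lt ?_ ?_
  · rw [norm_mul, norm_mul, mul_comm]
    exact mul_lt_mul_of_pos_left (hmono (by lia)) (denNorm_pos ha (n := r + 1) (by lia))
  · rw [norm_mul, norm_mul]
    exact mul_lt_mul_of_pos_right (hmono (by lia)) (denNorm_pos ha (n := r + 1 + s) (by lia))

theorem height_sub_le (P Q : F[X][X]) : height (P - Q) ≤ max (height P) (height Q) := by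
  refine height_le (le_max_of_le_left (height_nonneg P)) fun i => ?_
  rw [Polynomial.coeff_sub, map_sub, sub_eq_add_neg]
  refine (IsUltrametricDist.norm_add_le_max _ _).trans (max_le_max (norm_coeff_le_height P i) ?_)
  rw [norm_neg]
  exact norm_coeff_le_height Q i

/-- Numerators are no larger than denominators since p = qξ - (qξ - p) with |ξ| < 1; the limit ξ is
introduced only for this. -/
theorem height_lin_le (ha : ∀ n, 0 < (a (n + 1)).natDegree) (n : ℕ) :
    height (lin a (n + 1)) ≤ denNorm a (n + 1) := by
  obtain ⟨ξ, hξ⟩ := exists_isContFract ha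
  have hnum : ‖algebraMap F[X] (LaurentInf F) (num a (n + 1))‖ ≤ denNorm a (n + 1) := by
    have h1 : algebraMap F[X] (LaurentInf F) (num a (n + 1)) =
        algebraMap F[X] (LaurentInf F) (den a (n + 1)) * ξ + -rem a ξ (n + 1) := by rw [rem]; ring
    rw [h1]
    refine (IsUltrametricDist.norm_add_le_max _ _).trans (max_le ?_ ?_)
    · rw [norm_mul]
      exact mul_le_of_le_one_right (norm_nonneg _) (norm_lt_one_of_isContFract ha hξ).le
    · rw [norm_neg, norm_rem ha hξ]
      exact (inv_le_one_of_one_le₀ (one_le_denNorm ha (by lia))).trans (one_le_denNorm ha (by lia))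
  have hX : height (X : F[X][X]) ≤ 1 := height_le zero_le_one fun i => by
    rw [coeff_X]; split_ifs <;> simp
  refine (height_sub_le _ _).trans (max_le ?_ ?_)
  · rw [height_mul, height_C]
    exact mul_le_of_le_one_right (norm_nonneg _) hX
  · rwa [height_C]

theorem height_quad_le (ha : ∀ n, 0 < (a (n + 1)).natDegree) (r s : ℕ) :
    height (quad a (r + 1) s) ≤ denNorm a (r + 2) * denNorm a (r + 2 + s) := by
  have hmono := (strictMono_denNorm ha).monotone
  refine (height_sub_le _ _).trans (max_le ?_ ?_)
  · rw [height_mul]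
    refine mul_le_mul ((height_lin_le ha r).trans (hmono (by lia))) ?_ (height_nonneg _)
      (norm_nonneg _)
    rw [add_right_comm (r + 1) 1 s]
    exact (height_lin_le ha _).trans (hmono (by lia))
  · rw [height_mul, mul_comm]
    refine mul_le_mul ((height_lin_le ha _).trans (hmono (by lia))) ?_ (height_nonneg _)
      (norm_nonneg _)
    rw [add_right_comm r 1 s]
    exact (height_lin_le ha _).trans (hmono (by lia))

/-- For R = uX + v take the first q_N with |q_N| > |u|. Then u p_N + v q_N = q_N R(ξ) - u rem_N is a
nonzero polynomial and its second term is below 1, so |q_N R(ξ)| ≥ 1, while |q_N| ≤ M|u|. -/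
theorem le_norm_aeval_of_natDegree_eq_one (ha : ∀ n, 0 < (a (n + 1)).natDegree)
    {ξ : LaurentInf F} (hξ : IsContFract ξ a) {M : ℝ} (hM0 : 0 < M)
    (hM : ∀ n, ‖algebraMap F[X] (LaurentInf F) (a (n + 1))‖ ≤ M) {R : F[X][X]}
    (hR : R.natDegree = 1) : M⁻¹ / height R ≤ ‖aeval ξ R‖ := by
  set φ := algebraMap F[X] (LaurentInf F) with hφ
  set u := R.coeff 1 with hu
  set v := R.coeff 0 with hv
  have hu0 : u ≠ 0 := by
    rw [hu, ← hR, coeff_natDegree, leadingCoeff_ne_zero]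
    rintro rfl
    simp at hR
  have hval : aeval ξ R = φ u * ξ + φ v := by
    rw [aeval_eq_sum_range, hR, Finset.sum_range_succ, Finset.sum_range_one]
    simp only [Algebra.smul_def, pow_zero, pow_one, mul_one]
    ring
  have hu1 : 1 ≤ ‖φ u‖ := one_le_norm_algebraMap hu0
  have hex : ∃ N, ‖φ u‖ < denNorm a N := by
    obtain ⟨N, hN⟩ := pow_unbounded_of_one_lt ‖φ u‖ (one_lt_card (F := F))
    exact ⟨N + 1, hN.trans_le (pow_le_denNorm ha N)⟩
  classical
  have hN := Nat.find_spec hex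
  have hmin := fun {m} => Nat.find_min hex (m := m)
  set N := Nat.find hex with hNdef
  obtain ⟨n, hn⟩ : ∃ n, N = n + 2 := by
    refine ⟨N - 2, ?_⟩
    by_contra hlt
    have h1 := (strictMono_denNorm ha).monotone (show N ≤ 1 by lia)
    rw [denNorm_one] at h1
    linarith
  rw [hn] at hN hmin
  have hle : denNorm a (n + 1) ≤ ‖φ u‖ := not_lt.mp (hmin (by lia))
  have hNM : denNorm a (n + 2) ≤ M * ‖φ u‖ := by
    rw [denNorm_add_two ha]
    exact mul_le_mul (hM n) hle (norm_nonneg _) hM0.le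
  -- Otherwise coprimality would make q_N divide u, against |q_N| > |u|.
  have hne : u * num a (n + 2) + v * den a (n + 2) ≠ 0 := by
    intro h0
    have hdvd : den a (n + 2) ∣ u * num a (n + 2) :=
      ⟨-v, by linear_combination h0⟩
    have hdvd' := (isCoprime_num_den a (n + 2)).symm.dvd_of_dvd_mul_right hdvd
    have hd := norm_algebraMap_mono hu0 (natDegree_le_of_dvd hdvd' hu0)
    rw [← denNorm_def] at hd
    linarith
  have h1 := one_le_norm_algebraMap hne
  have h2 : φ (u * num a (n + 2) + v * den a (n + 2)) =
      φ (den a (n + 2)) * aeval ξ R + -(φ u * rem a ξ (n + 2)) := by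
    rw [hval, rem, map_add, map_mul, map_mul]; ring
  have h3 : ‖φ u * rem a ξ (n + 2)‖ < 1 := by
    rw [norm_mul, norm_rem ha hξ, ← div_eq_mul_inv, div_lt_one (denNorm_pos ha (by lia))]
    exact hN.trans (strictMono_denNorm ha (by lia))
  rw [← hφ, h2] at h1
  have h4 : 1 ≤ denNorm a (n + 2) * ‖aeval ξ R‖ := by
    rcases le_max_iff.mp (h1.trans (IsUltrametricDist.norm_add_le_max _ _)) with h | h
    · rwa [norm_mul] at h
    · rw [norm_neg] at h; linarith
  have hH : ‖φ u‖ ≤ height R := norm_coeff_le_height R 1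
  have hHpos : 0 < height R := by linarith
  rw [div_le_iff₀ hHpos, inv_le_iff_one_le_mul₀' hM0]
  calc 1 ≤ denNorm a (n + 2) * ‖aeval ξ R‖ := h4
    _ ≤ M * ‖φ u‖ * ‖aeval ξ R‖ := mul_le_mul_of_nonneg_right hNM (norm_nonneg _)
    _ ≤ M * height R * ‖aeval ξ R‖ := by gcongr
    _ = M * (‖aeval ξ R‖ * height R) := by ring

end Norms

end LaurentInf
end

/-! ### Block structure of the sequence of partial quotients -/

noncomputable section

/-- The position `⌊w ^ i⌋` of the `i`-th partial quotient `b`. -/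
def powFloor (w : ℝ) (i : ℕ) : ℕ := ⌊w ^ i⌋₊

/-- The length `⌊η w ^ i⌋` of the period in the `i`-th block. -/
def periodLen (w η : ℝ) (i : ℕ) : ℕ := ⌊η * w ^ i⌋₊

section PartialQuot

variable {F : Type*} [Field F] {w η : ℝ} {a b c : F[X]}

theorem intFloor_pow (hw : 0 ≤ w) (i : ℕ) : ⌊w ^ i⌋ = (powFloor w i : ℤ) :=
  (Int.natCast_floor_eq_floor (by positivity)).symm

theorem intFloor_mul_pow (hw : 0 ≤ w) (hη : 0 ≤ η) (i : ℕ) :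
    ⌊η * w ^ i⌋ = (periodLen w η i : ℤ) :=
  (Int.natCast_floor_eq_floor (by positivity)).symm

theorem powFloor_le (hw : 0 ≤ w) (i : ℕ) : (powFloor w i : ℝ) ≤ w ^ i :=
  Nat.floor_le (by positivity)

theorem lt_powFloor_add_one (w : ℝ) (i : ℕ) : w ^ i < powFloor w i + 1 := Nat.lt_floor_add_one _

theorem periodLen_le (hw : 0 ≤ w) (hη : 0 ≤ η) (i : ℕ) : (periodLen w η i : ℝ) ≤ η * w ^ i :=
  Nat.floor_le (by positivity)

theorem lt_periodLen_add_one (w η : ℝ) (i : ℕ) : η * w ^ i < periodLen w η i + 1 :=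
  Nat.lt_floor_add_one _

theorem powFloor_add_two_le (hw : 4 ≤ w) (i : ℕ) : powFloor w i + 2 ≤ powFloor w (i + 1) := by
  have h0 : (1 : ℝ) ≤ w ^ i := one_le_pow₀ (by linarith)
  have h1 := powFloor_le (by linarith : 0 ≤ w) i
  refine Nat.le_floor ?_
  push_cast
  rw [pow_succ]
  nlinarith

theorem strictMono_powFloor (hw : 4 ≤ w) : StrictMono (powFloor w) :=
  strictMono_nat_of_lt_succ fun i => by have := powFloor_add_two_le hw i; lia

theorem partialQuot_powFloor (hw : 0 ≤ w) (i : ℕ) :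
    partialQuot w η a b c (powFloor w i) = b := by
  rw [partialQuot, if_pos ⟨i, (intFloor_pow hw i).symm⟩]

/-- The final + 1 comes from ⌊w^i - 1⌋ in m_i: a block may overshoot its end ⌊w^(i+1)⌋ by one place.
-/
theorem le_blockCount_iff (hw : 0 ≤ w) (hη : 0 ≤ η) {i : ℕ} {m : ℤ} (hm : 1 ≤ m) :
    m ≤ blockCount w η i ↔ 0 < periodLen w η i ∧
      powFloor w i + m * periodLen w η i ≤ powFloor w (i + 1) + 1 := by
  rw [blockCount, Int.floor_sub_one, intFloor_pow hw, intFloor_pow hw, intFloor_mul_pow hw hη]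
  rcases Nat.eq_zero_or_pos (periodLen w η i) with h0 | h0
  · rw [h0]
    simp only [Nat.cast_zero, Int.cast_zero, div_zero, Int.floor_zero]
    constructor
    · intro h; lia
    · rintro ⟨h, -⟩; lia
  · have hr : (0 : ℝ) < ((periodLen w η i : ℤ) : ℝ) := by exact_mod_cast h0
    rw [Int.le_floor, le_div_iff₀ hr, ← Int.cast_mul, Int.cast_le]
    constructor
    · intro h; exact ⟨h0, by linarith⟩
    · rintro ⟨-, h⟩; linarith

theorem powFloor_ne_of_lt_of_lt (hw : 4 ≤ w) {j n : ℕ} (h1 : powFloor w j < n)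
    (h2 : n < powFloor w (j + 1)) : ¬ ∃ i : ℕ, (n : ℤ) = ⌊w ^ i⌋ := by
  rintro ⟨i, hi⟩
  rw [intFloor_pow (by linarith)] at hi
  have hi' : n = powFloor w i := by exact_mod_cast hi
  have hmono := strictMono_powFloor hw
  rw [hi', hmono.lt_iff_lt] at h1 h2
  lia

theorem partialQuot_ne_of_lt_of_lt (hw : 4 ≤ w) (hab : a ≠ b) (hbc : b ≠ c) {j n : ℕ}
    (h1 : powFloor w j < n) (h2 : n < powFloor w (j + 1)) : partialQuot w η a b c n ≠ b := by
  rw [partialQuot, if_neg (powFloor_ne_of_lt_of_lt hw h1 h2)]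
  split_ifs
  · exact hbc.symm
  · exact hab

/-- Offset 1 is excluded because an earlier block may overshoot onto it; no earlier block reaches
further, and later blocks begin too late. -/
theorem partialQuot_of_lt_of_lt (hw : 4 ≤ w) (hη : 0 ≤ η) {j t : ℕ} (hj : 1 ≤ j) (h1 : 2 ≤ t)
    (h2 : powFloor w j + t < powFloor w (j + 1)) :
    partialQuot w η a b c (powFloor w j + t) = if periodLen w η j ∣ t then c else a := by
  have hw0 : 0 ≤ w := by linarith
  have hmono := (strictMono_powFloor hw).monotone
  rw [partialQuot, if_neg (powFloor_ne_of_lt_of_lt hw (j := j) (by lia) h2)]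
  by_cases hdvd : periodLen w η j ∣ t
  swap
  · rw [if_neg hdvd, if_neg]
    rintro ⟨i, hi, m, hm, hmi, hn⟩
    rw [intFloor_pow hw0, intFloor_mul_pow hw0 hη] at hn
    rw [le_blockCount_iff hw0 hη hm] at hmi
    obtain ⟨hk, hle⟩ := hmi
    rcases lt_trichotomy i j with hij | hij | hij
    · have := hmono (show i + 1 ≤ j by lia)
      lia
    · subst hij
      have : (t : ℤ) = m * periodLen w η i := by push_cast at hn; linarith
      exact hdvd (Int.natCast_dvd_natCast.mp ⟨m, by rw [this, mul_comm]⟩)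
    · have := hmono (show j + 1 ≤ i by lia)
      have : 0 ≤ m * (periodLen w η i : ℤ) := by positivity
      lia
  · rw [if_pos hdvd, if_pos]
    obtain ⟨m, hm⟩ := hdvd
    have hk : 0 < periodLen w η j := Nat.pos_of_ne_zero fun h0 => by rw [h0] at hm; lia
    have hm1 : 1 ≤ m := Nat.one_le_iff_ne_zero.mpr fun h0 => by rw [h0] at hm; lia
    have hmZ : (t : ℤ) = m * periodLen w η j := by rw [hm]; push_cast; ring
    refine ⟨j, hj, m, by exact_mod_cast hm1, ?_, ?_⟩
    · rw [le_blockCount_iff hw0 hη (by exact_mod_cast hm1), ← hmZ]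
      exact ⟨hk, by lia⟩
    · rw [intFloor_pow hw0, intFloor_mul_pow hw0 hη, ← hmZ]
      push_cast; ring

/-- If the entry after ⌊w^j⌋ is a, the period starts right after ⌊w^j⌋, where b faces c one period
later. Otherwise it starts one place later, and the irregular entry faces a. Either way there is a
mismatch at r, as `norm_coeff_two_quad` requires. -/
theorem exists_preperiod (hw : 4 ≤ w) (hη : 0 ≤ η) (hbc : b ≠ c)
    {j : ℕ} (hj : 1 ≤ j) (hk : 3 ≤ periodLen w η j)
    (hlt : powFloor w j + 2 * periodLen w η j + 3 < powFloor w (j + 1)) :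
    ∃ r, powFloor w j ≤ r ∧ r ≤ powFloor w j + 1 ∧
      partialQuot w η a b c (r + periodLen w η j) ≠ partialQuot w η a b c r ∧
      ∀ n, r < n → n + periodLen w η j < powFloor w (j + 1) →
        partialQuot w η a b c (n + periodLen w η j) = partialQuot w η a b c n := by
  set k := periodLen w η j with hkdef
  set W := powFloor w j with hW
  have hval : ∀ t, 2 ≤ t → W + t < powFloor w (j + 1) →
      partialQuot w η a b c (W + t) = if k ∣ t then c else a :=
    fun t h1 h2 => partialQuot_of_lt_of_lt hw hη hj h1 h2
  have hper : ∀ n, W + 1 < n → n + k < powFloor w (j + 1) →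
      partialQuot w η a b c (n + k) = partialQuot w η a b c n := by
    intro n hn hn'
    obtain ⟨t, rfl⟩ : ∃ t, n = W + t := ⟨n - W, by lia⟩
    rw [add_assoc, hval (t + k) (by lia) (by lia), hval t (by lia) (by lia)]
    simp
  have hnd : ¬ k ∣ 1 + k := by
    rw [Nat.dvd_add_self_right, Nat.dvd_one]; lia
  have hone : partialQuot w η a b c (W + 1 + k) = a := by
    rw [add_assoc, hval (1 + k) (by lia) (by lia), if_neg hnd]
  by_cases h1 : partialQuot w η a b c (W + 1) = a
  · refine ⟨W, le_rfl, by lia, ?_, fun n hn hn' => ?_⟩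
    · rw [hval k (by lia) (by lia), if_pos (dvd_refl k), partialQuot_powFloor (by linarith)]
      exact hbc.symm
    · rcases (Nat.succ_le_of_lt hn).eq_or_lt with h | h
      · rw [← h, Nat.succ_eq_add_one, hone, h1]
      · exact hper n h hn'
  · refine ⟨W + 1, by lia, le_rfl, ?_, hper⟩
    rw [hone]
    exact fun h => h1 h.symm

end PartialQuot

/-! ### Sparsity of the partial quotients other than a -/

section Density

open Classical in
/-- The number of indices `1 ≤ i ≤ n` with `y i ≠ x`. -/
def countNe {α : Type*} (y : ℕ → α) (x : α) (n : ℕ) : ℕ :=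
  ((Finset.Icc 1 n).filter fun i => y i ≠ x).card

theorem countNe_mono {α : Type*} (y : ℕ → α) (x : α) : Monotone (countNe y x) := fun m n h => by
  classical
  exact Finset.card_le_card (Finset.filter_subset_filter _ (Finset.Icc_subset_Icc_right h))

theorem countNe_le_add {α : Type*} {y : ℕ → α} {x : α} {m n : ℕ} {S : Finset ℕ}
    (h : ∀ i, m < i → i ≤ n → y i ≠ x → i ∈ S) : countNe y x n ≤ countNe y x m + S.card := by
  classical
  refine (Finset.card_le_card (t := ((Finset.Icc 1 m).filter fun i => y i ≠ x) ∪ S) ?_).trans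
    (Finset.card_union_le _ _)
  intro i hi
  simp only [Finset.mem_filter, Finset.mem_Icc, Finset.mem_union] at hi ⊢
  by_cases him : i ≤ m
  · exact Or.inl ⟨⟨hi.1.1, him⟩, hi.2⟩
  · exact Or.inr (h i (not_le.mp him) hi.1.2 hi.2)

theorem countNe_succ_of_ne {α : Type*} {y : ℕ → α} {x : α} {n : ℕ} (h : y (n + 1) ≠ x) :
    countNe y x (n + 1) = countNe y x n + 1 := by
  classical
  rw [countNe, countNe, ← Finset.insert_Icc_right_eq_Icc_add_one (by lia : 1 ≤ n + 1),
    Finset.filter_insert, if_pos h, Finset.card_insert_of_notMem (by simp)]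

variable {F : Type*} [Field F] {w η : ℝ} {a b c : F[X]}

/-- Block length over period length is bounded in terms of w/η, so each late block contributes a
bounded number of exceptions and the count is linear in j. -/
theorem exists_countNe_powFloor_le (hw : 4 ≤ w) (hη : 0 < η) : ∃ C : ℕ, ∀ j n,
    n ≤ powFloor w (j + 1) → countNe (partialQuot w η a b c) a n ≤ C * (j + 1) := by
  have hw0 : 0 ≤ w := by linarith
  set T := ⌈2 * w / η⌉₊ with hT
  obtain ⟨J, hJ⟩ := eventually_atTop.mp
    (((tendsto_pow_atTop_atTop_of_one_lt (by linarith : 1 < w)).const_mul_atTop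
      hη).eventually_ge_atTop 2)
  set N := countNe (partialQuot w η a b c) a with hN
  have hstep : ∀ j, J + 1 ≤ j → N (powFloor w (j + 1)) ≤ N (powFloor w j) + (T + 3) := by
    intro j hj
    have hk2 := hJ j (by lia)
    have hk := lt_periodLen_add_one w η j
    have hkpos : 0 < periodLen w η j := by
      have : (0 : ℝ) < periodLen w η j := by linarith
      exact_mod_cast this
    -- Exceptions: the possible overshoot at the start, the b at the end, and multiples of the
    -- period. There are at most ⌈2w/η⌉ + 1 of the latter, as the period is at least ηw^j/2.
    refine (countNe_le_add (m := powFloor w j) (S := {powFloor w j + 1, powFloor w (j + 1)} ∪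
      (Finset.range (T + 1)).image fun m => powFloor w j + periodLen w η j * m) ?_).trans ?_
    · intro i hi1 hi2 hne
      by_contra hmem
      simp only [Finset.mem_union, Finset.mem_insert, Finset.mem_singleton, Finset.mem_image,
        Finset.mem_range, not_or] at hmem
      obtain ⟨⟨hm1, hm2⟩, hm3⟩ := hmem
      obtain ⟨t, rfl⟩ : ∃ t, i = powFloor w j + t := ⟨i - powFloor w j, by lia⟩
      rw [partialQuot_of_lt_of_lt hw hη.le (by lia) (by lia) (by lia)] at hne
      by_cases hdvd : periodLen w η j ∣ t
      · obtain ⟨m, rfl⟩ := hdvd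
        refine hm3 ⟨m, ?_, rfl⟩
        rw [Nat.lt_succ_iff]
        have h1 : ((periodLen w η j * m : ℕ) : ℝ) ≤ w ^ (j + 1) := by
          refine le_trans ?_ (powFloor_le hw0 (j + 1))
          exact_mod_cast (by lia : periodLen w η j * m ≤ powFloor w (j + 1))
        have hwj : 0 < w ^ j := by positivity
        have h2 : η * w ^ j / 2 * m ≤ w ^ (j + 1) := by
          refine le_trans ?_ h1
          push_cast
          exact mul_le_mul_of_nonneg_right (by linarith) (by positivity)
        have h3 : (m : ℝ) ≤ 2 * w / η := by
          rw [le_div_iff₀ hη]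
          rw [pow_succ] at h2
          have : w ^ j * (m * η) ≤ w ^ j * (2 * w) := by linarith
          exact le_of_mul_le_mul_left this hwj
        exact_mod_cast h3.trans (Nat.le_ceil _)
      · exact hne (if_neg hdvd)
    · refine Nat.add_le_add_left ((Finset.card_union_le _ _).trans ?_) _
      have h1 := Finset.card_le_two (a := powFloor w j + 1) (b := powFloor w (j + 1))
      have h2 := Finset.card_image_le (s := Finset.range (T + 1))
        (f := fun m => powFloor w j + periodLen w η j * m)
      rw [Finset.card_range] at h2
      lia
  have hind : ∀ i, N (powFloor w (J + 1 + i)) ≤ N (powFloor w (J + 1)) + (T + 3) * i := by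
    intro i
    induction i with
    | zero => simp
    | succ i ih =>
      have := hstep (J + 1 + i) (by lia)
      rw [← add_assoc, mul_add]
      lia
  refine ⟨N (powFloor w (J + 1)) + (T + 3), fun j n hn => ?_⟩
  have h1 := hind (j + 1)
  have h2 := countNe_mono (partialQuot w η a b c) a
    (hn.trans ((strictMono_powFloor hw).monotone (show j + 1 ≤ J + 1 + (j + 1) by lia)))
  refine (h2.trans h1).trans ?_
  rw [add_mul (N _)]
  exact Nat.add_le_add_right (Nat.le_mul_of_pos_right _ (Nat.succ_pos j)) _

end Density
end

/-! ### Asymptotics of the approximations and conclusion -/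

noncomputable section

theorem tendsto_div_pow_of_abs_sub_le {w : ℝ} (hw : 1 < w) {f : ℕ → ℝ} {x B : ℝ} (J : ℕ)
    (h : ∀ i, |f i - x * w ^ (i + J)| ≤ B * ((i + J : ℕ) + 1)) :
    Tendsto (fun i => f i / w ^ i) atTop (𝓝 (x * w ^ J)) := by
  have h1 : Tendsto (fun i : ℕ => B * ((i : ℝ) ^ 1 / w ^ i + (J + 1) * ((i : ℝ) ^ 0 / w ^ i)))
      atTop (𝓝 0) := by
    have := ((tendsto_pow_const_div_const_pow_of_one_lt 1 hw).add
      ((tendsto_pow_const_div_const_pow_of_one_lt 0 hw).const_mul ((J : ℝ) + 1))).const_mul B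
    simpa using this
  rw [tendsto_iff_norm_sub_tendsto_zero]
  refine squeeze_zero (fun _ => norm_nonneg _) (fun i => ?_) h1
  have hwi : 0 < w ^ i := pow_pos (by linarith) i
  have h2 : f i / w ^ i - x * w ^ J = (f i - x * w ^ (i + J)) / w ^ i := by
    rw [pow_add]; field_simp
  rw [h2, Real.norm_eq_abs, abs_div, abs_of_pos hwi, div_le_iff₀ hwi]
  refine (h i).trans_eq ?_
  push_cast
  field_simp
  ring

namespace LaurentInf

variable {F : Type*} [Field F] [Finite F] {a b c : F[X]} {w η : ℝ}

/-- log|q_n| is additive in the partial quotients, so only those different from x contribute to the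
error, each at most D. -/
theorem abs_log_denNorm_sub_le {y : ℕ → F[X]} (hy : ∀ n, 0 < (y (n + 1)).natDegree) {x : F[X]}
    {D : ℝ} (hD : ∀ n, |Real.log ‖algebraMap F[X] (LaurentInf F) (y (n + 1))‖ -
      Real.log ‖algebraMap F[X] (LaurentInf F) x‖| ≤ D) (n : ℕ) :
    |Real.log (denNorm y (n + 1)) - n * Real.log ‖algebraMap F[X] (LaurentInf F) x‖|
      ≤ D * countNe y x n := by
  have hD0 : 0 ≤ D := (abs_nonneg _).trans (hD 0)
  induction n with
  | zero => simp only [zero_add, denNorm_one, Real.log_one]; simp; positivity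
  | succ n ih =>
    have hne : y (n + 1) ≠ 0 := fun h => by simpa [h] using hy n
    have hpos : 0 < ‖algebraMap F[X] (LaurentInf F) (y (n + 1))‖ :=
      zero_lt_one.trans_le (one_le_norm_algebraMap hne)
    have hlog : Real.log (denNorm y (n + 1 + 1)) =
        Real.log ‖algebraMap F[X] (LaurentInf F) (y (n + 1))‖ + Real.log (denNorm y (n + 1)) := by
      rw [denNorm_add_two hy, Real.log_mul hpos.ne' (denNorm_pos hy (by lia)).ne']
    by_cases h : y (n + 1) = x
    · have hmono : (countNe y x n : ℝ) ≤ countNe y x (n + 1) := by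
        exact_mod_cast countNe_mono y x (Nat.le_succ n)
      refine le_trans (le_of_eq ?_) (ih.trans (mul_le_mul_of_nonneg_left hmono hD0))
      rw [hlog, h]
      push_cast
      congr 1
      ring
    · rw [hlog, countNe_succ_of_ne h]
      have h1 := hD n
      rw [abs_le] at ih h1 ⊢
      push_cast
      constructor <;> linarith [ih.1, ih.2, h1.1, h1.2]

omit [Finite F] in
theorem partialQuot_mem (w η : ℝ) (a b c : F[X]) (n : ℕ) :
    partialQuot w η a b c n = a ∨ partialQuot w η a b c n = b ∨ partialQuot w η a b c n = c := by
  rw [partialQuot]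
  split_ifs <;> simp

theorem exists_abs_log_denNorm_sub_le (ha : 0 < a.natDegree) (hb : 0 < b.natDegree)
    (hc : 0 < c.natDegree) (hw : 4 ≤ w) (hη : 0 < η) :
    ∃ C : ℝ, ∀ j n, n ≤ powFloor w (j + 1) →
      |Real.log (denNorm (partialQuot w η a b c) (n + 1)) -
        n * Real.log ‖algebraMap F[X] (LaurentInf F) a‖| ≤ C * ((j : ℝ) + 1) := by
  set φ := algebraMap F[X] (LaurentInf F)
  obtain ⟨C, hC⟩ := exists_countNe_powFloor_le (F := F) (a := a) (b := b) (c := c) hw hη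
  set D := max |Real.log ‖φ b‖ - Real.log ‖φ a‖| |Real.log ‖φ c‖ - Real.log ‖φ a‖| with hDdef
  have hD0 : 0 ≤ D := le_max_of_le_left (abs_nonneg _)
  refine ⟨D * C, fun j n hn => (abs_log_denNorm_sub_le (D := D) ?_ ?_ n).trans ?_⟩
  · intro n
    rcases partialQuot_mem w η a b c (n + 1) with h | h | h <;> rw [h] <;> assumption
  · intro n
    rcases partialQuot_mem w η a b c (n + 1) with h | h | h <;> rw [h]
    · rw [sub_self, abs_zero]; exact hD0
    · exact le_max_left _ _
    · exact le_max_right _ _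
  · rw [mul_assoc]
    exact mul_le_mul_of_nonneg_left (by exact_mod_cast hC j n hn) hD0

theorem powFloor_add_periodLen_lt (hw : 16 ≤ w) (hη : 0 ≤ η) (hηw : 4 * η ≤ w) (j : ℕ) :
    powFloor w j + 2 * periodLen w η j + 3 < powFloor w (j + 1) := by
  have h0 : (1 : ℝ) ≤ w ^ j := one_le_pow₀ (by linarith)
  have h1 := powFloor_le (by linarith : 0 ≤ w) j
  have h2 := periodLen_le (by linarith : 0 ≤ w) hη j
  have h3 := lt_powFloor_add_one w (j + 1)
  rw [pow_succ'] at h3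
  have h4 : (1 + 2 * η + 4) * w ^ j ≤ w * w ^ j :=
    mul_le_mul_of_nonneg_right (by linarith) (by linarith)
  have : ((powFloor w j + 2 * periodLen w η j + 3 : ℕ) : ℝ) < powFloor w (j + 1) := by
    push_cast
    linarith
  exact_mod_cast this

set_option maxHeartbeats 1600000 in
/-- The quadratic polynomials attached to the blocks of `partialQuot w η a b c`. -/
theorem exists_isQuadraticApprox (ha : 0 < a.natDegree) (hb : 0 < b.natDegree)
    (hc : 0 < c.natDegree) (hab : a ≠ b) (hac : a ≠ c) (hbc : b ≠ c) (hw : 16 ≤ w) (hη : 0 < η)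
    (hηw : 4 * η ≤ w) {ξ : LaurentInf F} (hξ : IsContFract ξ (partialQuot w η a b c)) :
    ∃ κ : ℝ, 0 < κ ∧ ∃ Q, IsQuadraticApprox w η κ ξ Q := by
  set y := partialQuot w η a b c with hy
  set φ := algebraMap F[X] (LaurentInf F) with hφ
  have hw0 : 0 ≤ w := by linarith
  have hw1 : 1 < w := by linarith
  have hw4 : 4 ≤ w := by linarith
  have hy0 : ∀ n, 0 < (y (n + 1)).natDegree := fun n => by
    rcases partialQuot_mem w η a b c (n + 1) with h | h | h <;> rw [hy, h] <;> assumption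
  obtain ⟨C₀, hC⟩ := exists_abs_log_denNorm_sub_le (F := F) ha hb hc hw4 hη
  rw [← hy] at hC
  set l := Real.log ‖φ a‖ with hl
  have ha0 : a ≠ 0 := fun h => by simp [h] at ha
  have hl0 : 0 < l := by
    rw [hl, hφ, norm_algebraMap ha0, Real.log_pow]
    exact mul_pos (by exact_mod_cast ha) (Real.log_pos one_lt_card)
  set M := max ‖φ a‖ (max ‖φ b‖ ‖φ c‖) with hM
  have hM1 : 1 ≤ M := le_max_of_le_left (one_le_norm_algebraMap ha0)
  have hyM : ∀ n, ‖φ (y n)‖ ≤ M := fun n => by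
    rcases partialQuot_mem w η a b c n with h | h | h <;> rw [hy, h, hM] <;> simp
  -- Blocks with ηw^j < 3 may be too short for the analysis. They are dropped by shifting the index
  -- by J', which later puts the factor w^J' into κ.
  obtain ⟨J, hJ⟩ := eventually_atTop.mp
    (((tendsto_pow_atTop_atTop_of_one_lt hw1).const_mul_atTop hη).eventually_ge_atTop 3)
  set J' := J + 1 with hJ'
  set k := fun i => periodLen w η (i + J') with hk
  set W := fun i => powFloor w (i + J') with hW
  set e := fun i => powFloor w (i + J' + 1) with he
  have hk3 : ∀ i, 3 ≤ k i := fun i => Nat.le_floor (by exact_mod_cast hJ (i + J') (by lia))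
  have hlt : ∀ i, W i + 2 * k i + 3 < e i := fun i =>
    powFloor_add_periodLen_lt hw hη.le hηw (i + J')
  have hpre := fun i => exists_preperiod (a := a) hw4 hη.le hbc (j := i + J') (by lia) (hk3 i)
    (hlt i)
  choose r hr1 hr2 hr3 hr4 using hpre
  have hW1 : ∀ i, 1 ≤ W i := fun i => Nat.le_floor (by
    rw [Nat.cast_one]; exact one_le_pow₀ hw1.le)
  have hr1' : ∀ i, W i ≤ r i := hr1
  have hr2' : ∀ i, r i ≤ W i + 1 := hr2
  have hr3' : ∀ i, y (r i + k i) ≠ y (r i) := hr3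
  have hr4' : ∀ i n, r i < n → n + k i < e i → y (n + k i) = y n := hr4
  have hH1 : ∀ i, denNorm y (r i) * denNorm y (r i + k i) ≤ height (quad y (r i) (k i)) ∧
      height (quad y (r i) (k i)) ≤ denNorm y (r i + 1) * denNorm y (r i + 1 + k i) ∧
      (quad y (r i) (k i)).coeff 2 ≠ 0 := by
    intro i
    obtain ⟨t, ht⟩ : ∃ t, r i = t + 1 := ⟨r i - 1, by have := hr1' i; have := hW1 i; lia⟩
    have hne := hr3' i
    rw [ht] at hne ⊢
    have h1 := norm_coeff_two_quad hy0 hne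
    have hδ := one_le_norm_algebraMap (sub_ne_zero.mpr hne)
    have hpos : 0 < denNorm y (t + 1) * denNorm y (t + 1 + k i) :=
      mul_pos (denNorm_pos hy0 (by lia)) (denNorm_pos hy0 (by lia))
    refine ⟨?_, height_quad_le hy0 t (k i), fun h0 => ?_⟩
    · refine (le_mul_of_one_le_left hpos.le hδ).trans ?_
      rw [← h1]
      exact norm_coeff_le_height _ _
    · rw [h0, map_zero, norm_zero] at h1
      exact (mul_pos (zero_lt_one.trans_le hδ) hpos).ne h1
  have hV : ∀ i, ‖aeval ξ (quad y (r i) (k i))‖ = ‖φ (y (e i) - y (e i - k i))‖ *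
      ((denNorm y (e i - k i + 1))⁻¹ * (denNorm y (e i + 1))⁻¹) ∧ y (e i) ≠ y (e i - k i) := by
    intro i
    have h1 := hlt i
    have h2 := hr2' i
    have hye : y (e i) = b := partialQuot_powFloor hw0 _
    have hyek : y (e i - k i) ≠ b :=
      partialQuot_ne_of_lt_of_lt hw4 hab hbc (j := i + J') (by simp only [hW, hk, he] at *; lia)
        (by have := hk3 i; simp only [hW, hk, he] at *; lia)
    have hne : y (e i) ≠ y (e i - k i) := by rw [hye]; exact hyek.symm
    refine ⟨?_, hne⟩
    -- Slide the window to the end of the periodic stretch, where the b at e breaks the period.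
    obtain ⟨t, ht⟩ : ∃ t, e i = r i + t + 1 + k i := ⟨e i - k i - 1 - r i, by lia⟩
    have ht' : e i - k i = r i + t + 1 := by lia
    have hper := quad_eq_or_neg y (r := r i) (s := k i) (i := t)
      fun n hn hn' => hr4' i n hn (by lia)
    rw [ht', ht] at hne
    have hval := norm_aeval_quad hy0 hξ hne
    have hnorm : ‖aeval ξ (quad y (r i) (k i))‖ = ‖aeval ξ (quad y (r i + t) (k i))‖ := by
      rcases hper with h | h <;> rw [h]
      rw [map_neg, norm_neg]
    rw [hnorm, hval, ht', ht, add_right_comm (r i + t + 1) (k i) 1]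
  have hdenpos : ∀ n, 0 < denNorm y (n + 1) := fun n => denNorm_pos hy0 (by lia)
  have hHpos : ∀ i, 0 < height (quad y (r i) (k i)) := fun i =>
    (mul_pos (denNorm_pos hy0 (by have := hr1' i; have := hW1 i; lia))
      (denNorm_pos hy0 (by have := hk3 i; lia))).trans_le (hH1 i).1
  have hCe : ∀ i n, n ≤ e i → |Real.log (denNorm y (n + 1)) - n * l| ≤
      C₀ * ((i + J' : ℕ) + 1) := fun i n hn => hC (i + J') n hn
  have hWl : ∀ i, (W i : ℝ) * l ≤ l * w ^ (i + J') ∧ l * w ^ (i + J') ≤ W i * l + l := by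
    intro i
    have h1 := mul_le_mul_of_nonneg_left (powFloor_le hw0 (i + J')) hl0.le
    have h2 := mul_le_mul_of_nonneg_left (lt_powFloor_add_one w (i + J')).le hl0.le
    simp only [hW]
    constructor <;> linarith
  have hkl : ∀ i, (k i : ℝ) * l ≤ l * η * w ^ (i + J') ∧
      l * η * w ^ (i + J') ≤ k i * l + l := by
    intro i
    have h1 := mul_le_mul_of_nonneg_left (periodLen_le hw0 hη.le (i + J')) hl0.le
    have h2 := mul_le_mul_of_nonneg_left (lt_periodLen_add_one w η (i + J')).le hl0.le
    simp only [hk]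
    constructor <;> linarith
  have hel : ∀ i, (e i : ℝ) * l ≤ l * w * w ^ (i + J') ∧
      l * w * w ^ (i + J') ≤ e i * l + l := by
    intro i
    have h1 := mul_le_mul_of_nonneg_left (powFloor_le hw0 (i + J' + 1)) hl0.le
    have h2 := mul_le_mul_of_nonneg_left (lt_powFloor_add_one w (i + J' + 1)).le hl0.le
    rw [pow_succ'] at h1 h2
    simp only [he]
    constructor <;> linarith
  have hrl : ∀ i, (W i : ℝ) * l ≤ r i * l ∧ (r i : ℝ) * l ≤ W i * l + l := by
    intro i
    have h1 : (W i : ℝ) ≤ r i := by exact_mod_cast hr1' i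
    have h2 : (r i : ℝ) ≤ W i + 1 := by exact_mod_cast hr2' i
    have h3 := mul_le_mul_of_nonneg_right h1 hl0.le
    have h4 := mul_le_mul_of_nonneg_right h2 hl0.le
    constructor <;> linarith
  have hgrow : ∀ {B : ℝ}, 0 ≤ B → ∀ i : ℕ, B ≤ B * ((i + J' : ℕ) + 1) := fun hB i =>
    le_mul_of_one_le_right hB (by
      have : (0 : ℝ) ≤ ((i + J' : ℕ) : ℝ) := Nat.cast_nonneg _
      linarith)
  refine ⟨l * w ^ J', by positivity, fun i => quad y (r i) (k i), ⟨?_, ?_, ?_, ?_, ?_, ?_, ?_, ?_,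
    ?_⟩⟩
  · exact (norm_lt_one_of_isContFract hy0 hξ).le
  · intro i
    exact le_antisymm (natDegree_quad_le y _ _) (le_natDegree_of_ne_zero (hH1 i).2.2)
  · intro i
    rw [← norm_pos_iff, (hV i).1]
    exact mul_pos (zero_lt_one.trans_le (one_le_norm_algebraMap (sub_ne_zero.mpr (hV i).2)))
      (mul_pos (inv_pos.mpr (hdenpos _)) (inv_pos.mpr (hdenpos _)))
  · intro i
    rw [← norm_pos_iff, norm_aeval_derivative_quad hy0 hξ _ (by have := hk3 i; lia),
      add_right_comm]
    exact mul_pos (hdenpos _) (inv_pos.mpr (hdenpos _))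
  · rw [show l * w ^ J' * (2 + η) = (l * (2 + η)) * w ^ J' by ring]
    refine tendsto_div_pow_of_abs_sub_le hw1 (B := 2 * C₀ + 5 * l) J' fun i => ?_
    obtain ⟨t, ht⟩ : ∃ t, r i = t + 1 := ⟨r i - 1, by have := hr1' i; have := hW1 i; lia⟩
    have h1 := hlt i
    have h2 := hr2' i
    have htr : (r i : ℝ) = t + 1 := by exact_mod_cast ht
    have hlow := Real.log_le_log (mul_pos (denNorm_pos hy0 (by lia)) (denNorm_pos hy0 (by lia)))
      (hH1 i).1
    have hupp := Real.log_le_log (hHpos i) (hH1 i).2.1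
    rw [add_right_comm (r i) 1 (k i), Real.log_mul (hdenpos _).ne' (hdenpos _).ne'] at hupp
    rw [show denNorm y (r i) = denNorm y (t + 1) by rw [ht],
      show denNorm y (r i + k i) = denNorm y (t + k i + 1) by rw [ht, add_right_comm],
      Real.log_mul (hdenpos _).ne' (hdenpos _).ne'] at hlow
    have c1 := abs_le.mp (hCe i t (by lia))
    have c2 := abs_le.mp (hCe i (t + k i) (by lia))
    have c3 := abs_le.mp (hCe i (r i) (by lia))
    have c4 := abs_le.mp (hCe i (r i + k i) (by lia))
    have hg := hgrow (B := 5 * l) (by positivity) i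
    have e1 := hWl i
    have e2 := hkl i
    have e3 := hrl i
    have e4 : (r i : ℝ) * l = t * l + l := by rw [htr]; ring
    push_cast at c2 c4 hg ⊢
    push_cast at c1 c3
    rw [abs_le]
    constructor <;> linarith [c1.1, c2.1, c3.2, c4.2, e1.1, e1.2, e2.1, e2.2, e3.1, e3.2]
  · rw [show -(l * w ^ J' * (2 * w - η)) = (-(l * (2 * w - η))) * w ^ J' by ring]
    refine tendsto_div_pow_of_abs_sub_le hw1 (B := 2 * C₀ + (Real.log M + 3 * l)) J' fun i => ?_
    have h1 := hlt i
    have hδ1 := one_le_norm_algebraMap (sub_ne_zero.mpr (hV i).2)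
    have hδpos := zero_lt_one.trans_le hδ1
    have hδM : ‖φ (y (e i) - y (e i - k i))‖ ≤ M := by
      rw [map_sub, sub_eq_add_neg]
      refine (IsUltrametricDist.norm_add_le_max _ _).trans (max_le (hyM _) ?_)
      rw [norm_neg]; exact hyM _
    have d1 := Real.log_nonneg hδ1
    have d2 := Real.log_le_log hδpos hδM
    have c1 := abs_le.mp (hCe i (e i - k i) (by lia))
    have c2 := abs_le.mp (hCe i (e i) le_rfl)
    have hcast : ((e i - k i : ℕ) : ℝ) = e i - k i := by
      rw [Nat.cast_sub (by lia)]
    rw [hcast] at c1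
    have hg := hgrow (B := Real.log M + 3 * l)
      (add_nonneg (Real.log_nonneg hM1) (by positivity)) i
    have e1 := hel i
    have e2 := hkl i
    rw [(hV i).1, Real.log_mul hδpos.ne'
      (mul_pos (inv_pos.mpr (hdenpos _)) (inv_pos.mpr (hdenpos _))).ne',
      Real.log_mul (inv_pos.mpr (hdenpos _)).ne' (inv_pos.mpr (hdenpos _)).ne', Real.log_inv,
      Real.log_inv]
    rw [abs_le]
    constructor <;> linarith [c1.1, c2.1, c1.2, c2.2, e1.1, e1.2, e2.1, e2.2]
  · rw [show l * w ^ J' * η = (l * η) * w ^ J' by ring]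
    refine tendsto_div_pow_of_abs_sub_le hw1 (B := 2 * C₀ + l) J' fun i => ?_
    have h1 := hlt i
    have h2 := hr2' i
    have c3 := abs_le.mp (hCe i (r i) (by lia))
    have c4 := abs_le.mp (hCe i (r i + k i) (by lia))
    have hg := hgrow hl0.le i
    have e2 := hkl i
    rw [Nat.cast_add (r i) (k i)] at c4
    rw [norm_aeval_derivative_quad hy0 hξ _ (by have := hk3 i; lia), add_right_comm,
      Real.log_mul (hdenpos _).ne' (inv_pos.mpr (hdenpos _)).ne', Real.log_inv]
    rw [abs_le]
    constructor <;> linarith [c3.1, c3.2, c4.1, c4.2, e2.1, e2.2]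
  · refine ⟨‖φ (c - a)‖, fun i g hg => ?_⟩
    have h1 := hlt i
    have h2 := hr2' i
    have h3 := hk3 i
    -- Slide the window one full period past ⌊w^j⌋, clear of the irregular entry: there it reads a,
    -- …, a, c, so any constant factor divides c - a.
    obtain ⟨t, ht⟩ : ∃ t, W i + k i = r i + t := ⟨W i + k i - r i, by lia⟩
    have hper := quad_eq_or_neg y (r := r i) (s := k i) (i := t)
      fun n hn hn' => hr4' i n hn (by lia)
    have hg' : C g ∣ quad y (W i + k i) (k i) := by
      rw [ht]
      rcases hper with h | h <;> rw [h]
      · exact hg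
      · exact (dvd_neg).mpr hg
    have hval : ∀ n, 2 ≤ n → W i + n < e i → y (W i + n) = if k i ∣ n then c else a :=
      fun n hn hn' => partialQuot_of_lt_of_lt hw4 hη.le (by lia) hn hn'
    have hdvd : g ∣ c - a := by
      refine dvd_sub_of_C_dvd_quad (by lia) (fun m hm hm' => ?_) ?_ hg'
      · rw [add_assoc, hval _ (by lia) (by lia), if_neg]
        rw [Nat.dvd_add_right (dvd_refl _)]
        exact Nat.not_dvd_of_pos_of_lt (by lia) hm'
      · rw [add_assoc, hval _ (by lia) (by lia), if_pos (dvd_add (dvd_refl _) (dvd_refl _))]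
    have hne := sub_ne_zero.mpr hac.symm
    exact norm_algebraMap_mono hne (natDegree_le_of_dvd hdvd hne)
  · exact ⟨M⁻¹, inv_pos.mpr (by linarith), fun R hR =>
      le_norm_aeval_of_natDegree_eq_one hy0 hξ (by linarith) (fun n => hyM (n + 1)) hR⟩

end LaurentInf

end

theorem mainTheorem3 {F : Type*} [Field F] [Finite F] (d : ℕ) (hd : 2 ≤ d)
    (w : ℝ) (hw : 121 * (d : ℝ) ^ 2 ≤ w)
    (η : ℝ) (hη0 : 0 < η) (hη : η < Real.sqrt w / d)
    (a b c : Polynomial F) (ha : 0 < a.natDegree) (hb : 0 < b.natDegree) (hc : 0 < c.natDegree)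
    (hab : a ≠ b) (hac : a ≠ c) (hbc : b ≠ c) :
    ∃ ξ : LaurentInf F, LaurentInf.IsContFract ξ (partialQuot w η a b c) ∧
      ∀ n : ℕ, 2 ≤ n → n ≤ d →
        LaurentInf.wStarExp n ξ = (((2 * w - 2 - η) / (2 + η) : ℝ) : EReal) ∧
        LaurentInf.wExp n ξ = (((2 * w - η) / (2 + η) : ℝ) : EReal) ∧
        LaurentInf.wExp n ξ - LaurentInf.wStarExp n ξ = ((2 / (2 + η) : ℝ) : EReal) := by
  have hd' : (2 : ℝ) ≤ d := by exact_mod_cast hd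
  have hw484 : 484 ≤ w := by nlinarith
  have hsq : Real.sqrt w ^ 2 = w := Real.sq_sqrt (by linarith)
  have hs : 22 ≤ Real.sqrt w := Real.le_sqrt_of_sq_le (by linarith)
  have hηw : 4 * η ≤ w := by
    rw [lt_div_iff₀ (by linarith)] at hη
    nlinarith
  obtain ⟨ξ, hξ⟩ := LaurentInf.exists_isContFract (a := partialQuot w η a b c) fun n => by
    rcases LaurentInf.partialQuot_mem w η a b c (n + 1) with h | h | h <;> rw [h] <;> assumption
  obtain ⟨κ, hκ, Q, hQ⟩ := LaurentInf.exists_isQuadraticApprox ha hb hc hab hac hbc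
    (by linarith) hη0 hηw hξ
  refine ⟨ξ, hξ, fun n hn hnd => ?_⟩
  obtain ⟨h1, h2⟩ := hQ.exponents_eq hκ hd hw hη0 hη hn hnd
  refine ⟨h2, h1, ?_⟩
  rw [h1, h2, ← EReal.coe_sub]
  congr 1
  have : 2 + η ≠ 0 := by linarith
  field_simp
  ring
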